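/- Conventions. All locally compact spaces are Hausdorff. A locally compact groupoid $\mathcal G$ with unit space $X=\mathcal G^{(0)}$, range and source maps $r,s:\mathcal G\to X$, is a groupoid with a locally compact topology for which the structure maps are continuous and $r$ is open ($X$ carries the induced topology); it is étale if $r:\mathcal G\to X$ is a local homeomorphism. Put $\mathcal G^x=r^{-1}(x)$. A locally compact groupoid $\mathcal G$ is amenable if there is a net $(m_i)_i$, each $m_i=(m_i^x)_{x\in X}$ being a family of Radon probability measures $m_i^x$ on $\mathcal G^x$, such that $x\mapsto\int f\,dm_i^x$ is continuous for every $i$ and every $f\in C_c(\mathcal G)$, and $\lim_i\|\gamma m_i^{s(\gamma)}-m_i^{r(\gamma)}\|_1=0$ uniformly on compact subsets of $\mathcal G$, where $\gamma m_i^{s(\gamma)}$ is the image of $m_i^{s(\gamma)}$ under $\gamma_1\mapsto\gamma\gamma_1$ and $\|\cdot\|_1$ is the total variation norm. A $\mathcal G$-space is a locally compact space $Y$ with a continuous surjection $p:Y\to X$ and a continuous action $(\gamma,y)\mapsto\gamma y$, defined on the pairs with $s(\gamma)=p(y)$, such that $p(\gamma y)=r(\gamma)$, $p(y)y=y$, and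 $(\gamma_2\gamma_1)y=\gamma_2(\gamma_1y)$ whenever $s(\gamma_2)=r(\gamma_1)$ and $s(\gamma_1)=p(y)$. Its semi-direct product groupoid $Y\rtimes\mathcal G$ is $\{(y,\gamma)\in Y\times\mathcal G: p(y)=r(\gamma)\}$ with the induced topology, with unit space $Y$, range $(y,\gamma)\mapsto y$, source $(y,\gamma)\mapsto\gamma^{-1}y$, product $(y,\gamma)(\gamma^{-1}y,\gamma_1)=(y,\gamma\gamma_1)$ and inverse $(y,\gamma)^{-1}=(\gamma^{-1}y,\gamma^{-1})$. The groupoid $\mathcal G$ is strongly amenable at infinity if there is a $\mathcal G$-space $(Y,p)$ such that $p$ is proper, $p$ has a continuous section $\sigma:X\to Y$, and the groupoid $Y\rtimes\mathcal G$ is amenable. A continuous homomorphism $\rho:\mathcal G\to\mathcal H$ between locally compact groupoids is locally proper if the map $\gamma\mapsto(r(\gamma),\rho(\gamma),s(\gamma))$ from $\mathcal G$ to $\mathcal G^{(0)}\times\mathcal H\times\mathcal G^{(0)}$ is proper. Proposition. Let $\mathcal G$ be an étale groupoid. Assume that there exists a locally proper continuous homomorphism $\rho$ from $\mathcal G$ into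 an étale groupoid $\mathcal H$ that is strongly amenable at infinity. Then $\mathcal G$ is strongly amenable at infinity. -/

import Mathlib

open Set Filter Topology MeasureTheory
open scoped CompactlySupported

universe u₀ u v₀ v w

/-- An (algebraic) groupoid with set of units `X` and set of arrows `G`.  The set `X` is identified
with a subset of `G` by the map `unit`; the product `mul a b _` is defined exactly for the
composable pairs, that is, when `s a = r b`. -/
structure GroupoidStr (X : Type u₀) (G : Type u) where
  /-- range -/
  r : G → X
  /-- source -/
  s : G → X
  /-- inclusion of the units -/
  unit : X → G
  /-- product of composable arrows -/
  mul : (a b : G) → s a = r b → G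
  /-- inverse -/
  inv : G → G
  r_unit : ∀ x, r (unit x) = x
  s_unit : ∀ x, s (unit x) = x
  r_mul : ∀ a b h, r (mul a b h) = r a
  s_mul : ∀ a b h, s (mul a b h) = s b
  r_inv : ∀ a, r (inv a) = s a
  s_inv : ∀ a, s (inv a) = r a
  mul_assoc : ∀ a b c (h₁ : s a = r b) (h₂ : s b = r c),
    mul (mul a b h₁) c ((s_mul a b h₁).trans h₂) = mul a (mul b c h₂) (h₁.trans (r_mul b c h₂).symm)
  unit_mul : ∀ a, mul (unit (r a)) a (s_unit (r a)) = a
  mul_unit : ∀ a, mul a (unit (s a)) (r_unit (s a)).symm = a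
  mul_inv : ∀ a, mul a (inv a) (r_inv a).symm = unit (r a)
  inv_mul : ∀ a, mul (inv a) a (s_inv a) = unit (s a)

namespace GroupoidStr

variable {X : Type u₀} {G : Type u}

/-- Locally compact (Hausdorff) groupoid with open range map.  The inclusion `unit` of the space of
units is a topological embedding, since it has the continuous left inverse `r`; so the topology of
`X` is the one induced by `G`. -/
structure IsLocallyCompactGroupoid [TopologicalSpace X] [TopologicalSpace G]
    (𝓖 : GroupoidStr X G) : Prop where
  t2Space : T2Space G
  locallyCompactSpace : LocallyCompactSpace G
  continuous_r : Continuous 𝓖.r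
  continuous_s : Continuous 𝓖.s
  continuous_unit : Continuous 𝓖.unit
  continuous_inv : Continuous 𝓖.inv
  continuous_mul :
    Continuous fun z : {z : G × G // 𝓖.s z.1 = 𝓖.r z.2} => 𝓖.mul z.1.1 z.1.2 z.2
  isOpenMap_r : IsOpenMap 𝓖.r

/-- Étale groupoid: a locally compact groupoid whose range map is a local homeomorphism. -/
structure IsEtale [TopologicalSpace X] [TopologicalSpace G] (𝓖 : GroupoidStr X G) : Prop
    extends IsLocallyCompactGroupoid 𝓖 where
  isLocalHomeomorph_r : IsLocalHomeomorph 𝓖.r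

/-- The fibre `r ⁻¹ {x}` of the range map. -/
def Fiber (𝓖 : GroupoidStr X G) (x : X) : Type u := {γ : G // 𝓖.r γ = x}

instance [TopologicalSpace G] (𝓖 : GroupoidStr X G) (x : X) : TopologicalSpace (𝓖.Fiber x) :=
  inferInstanceAs (TopologicalSpace {γ : G // 𝓖.r γ = x})

instance [TopologicalSpace G] (𝓖 : GroupoidStr X G) (x : X) : MeasurableSpace (𝓖.Fiber x) :=
  borel _

instance [TopologicalSpace G] (𝓖 : GroupoidStr X G) (x : X) : BorelSpace (𝓖.Fiber x) := ⟨rfl⟩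

/-- Left translation `γ₁ ↦ γ γ₁`, from the fibre over `s γ` to the fibre over `r γ`. -/
def translate (𝓖 : GroupoidStr X G) (γ : G) (γ₁ : 𝓖.Fiber (𝓖.s γ)) : 𝓖.Fiber (𝓖.r γ) :=
  ⟨𝓖.mul γ γ₁.1 γ₁.2.symm, 𝓖.r_mul _ _ _⟩

/-- For a family `m` of probability measures on the fibres of the range map, the total variation
norm of the signed measure `γ m^{s(γ)} - m^{r(γ)}`. -/
noncomputable def translationDefect [TopologicalSpace G] (𝓖 : GroupoidStr X G)
    (m : (x : X) → ProbabilityMeasure (𝓖.Fiber x)) (γ : G) : ℝ :=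
  (((m (𝓖.s γ) : Measure (𝓖.Fiber (𝓖.s γ))).map (𝓖.translate γ)).toSignedMeasure -
    (m (𝓖.r γ) : Measure (𝓖.Fiber (𝓖.r γ))).toSignedMeasure).totalVariation.real univ

/-- Amenability of a locally compact groupoid: there is a net of continuous families of Radon
probability measures on the fibres of the range map which is asymptotically invariant, uniformly on
compact sets of arrows. -/
def IsAmenable [TopologicalSpace X] [TopologicalSpace G] (𝓖 : GroupoidStr X G) : Prop :=
  ∃ (I : Type u) (_ : Preorder I) (_ : IsDirectedOrder I) (_ : Nonempty I)
    (m : I → (x : X) → ProbabilityMeasure (𝓖.Fiber x)),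
    (∀ i x, (m i x : Measure (𝓖.Fiber x)).Regular) ∧
    (∀ i, ∀ f : C_c(G, ℂ),
      Continuous fun x => ∫ γ : 𝓖.Fiber x, f γ.1 ∂(m i x : Measure (𝓖.Fiber x))) ∧
    ∀ K : Set G, IsCompact K →
      TendstoUniformlyOn (fun i γ => 𝓖.translationDefect (m i) γ) (fun _ => 0) atTop K

/-- A (left) `𝓖`-space: a locally compact Hausdorff space `Y`, fibred over the space of units by a
continuous surjective momentum map `p` (not assumed open), with a continuous action
`act γ y _`, defined when `s γ = p y`. -/
structure GSpace [TopologicalSpace X] [TopologicalSpace G] (𝓖 : GroupoidStr X G)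
    (Y : Type w) [TopologicalSpace Y] where
  t2Space : T2Space Y
  locallyCompactSpace : LocallyCompactSpace Y
  /-- momentum map -/
  p : Y → X
  continuous_p : Continuous p
  surjective_p : Function.Surjective p
  /-- action -/
  act : (γ : G) → (y : Y) → 𝓖.s γ = p y → Y
  continuous_act : Continuous fun z : {z : G × Y // 𝓖.s z.1 = p z.2} => act z.1.1 z.1.2 z.2
  p_act : ∀ γ y h, p (act γ y h) = 𝓖.r γ
  unit_act : ∀ y, act (𝓖.unit (p y)) y (𝓖.s_unit (p y)) = y
  mul_act : ∀ γ₂ γ₁ y (h : 𝓖.s γ₂ = 𝓖.r γ₁) (h₁ : 𝓖.s γ₁ = p y),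
    act (𝓖.mul γ₂ γ₁ h) y ((𝓖.s_mul γ₂ γ₁ h).trans h₁) =
      act γ₂ (act γ₁ y h₁) (h.trans (p_act γ₁ y h₁).symm)

namespace GSpace

variable [TopologicalSpace X] [TopologicalSpace G] {𝓖 : GroupoidStr X G}
  {Y : Type w} [TopologicalSpace Y]

theorem act_congr (𝓨 : GSpace 𝓖 Y) {γ γ' : G} {y y' : Y} (hγ : γ = γ') (hy : y = y')
    (h : 𝓖.s γ = 𝓨.p y) (h' : 𝓖.s γ' = 𝓨.p y') : 𝓨.act γ y h = 𝓨.act γ' y' h' := by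
  subst hγ hy
  rfl

theorem act_inv_act (𝓨 : GSpace 𝓖 Y) (γ : G) (y : Y) (h : 𝓖.s (𝓖.inv γ) = 𝓨.p y)
    (h' : 𝓖.s γ = 𝓨.p (𝓨.act (𝓖.inv γ) y h)) : 𝓨.act γ (𝓨.act (𝓖.inv γ) y h) h' = y := by
  rw [← 𝓨.mul_act γ (𝓖.inv γ) y (𝓖.r_inv γ).symm h]
  refine (𝓨.act_congr (γ' := 𝓖.unit (𝓨.p y)) ?_ rfl _ (𝓖.s_unit _)).trans (𝓨.unit_act y)
  rw [𝓖.mul_inv, ← h, 𝓖.s_inv]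

theorem inv_act_act (𝓨 : GSpace 𝓖 Y) (γ : G) (y : Y) (h : 𝓖.s γ = 𝓨.p y)
    (h' : 𝓖.s (𝓖.inv γ) = 𝓨.p (𝓨.act γ y h)) : 𝓨.act (𝓖.inv γ) (𝓨.act γ y h) h' = y := by
  rw [← 𝓨.mul_act (𝓖.inv γ) γ y (𝓖.s_inv γ) h]
  refine (𝓨.act_congr (γ' := 𝓖.unit (𝓨.p y)) ?_ rfl _ (𝓖.s_unit _)).trans (𝓨.unit_act y)
  rw [𝓖.inv_mul, ← h]

theorem inv_mul_act (𝓨 : GSpace 𝓖 Y) (a b : G) (y : Y) (hab : 𝓖.s a = 𝓖.r b)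
    (h : 𝓖.s (𝓖.inv (𝓖.mul a b hab)) = 𝓨.p y) (h₁ : 𝓖.s (𝓖.inv a) = 𝓨.p y)
    (h₂ : 𝓖.s (𝓖.inv b) = 𝓨.p (𝓨.act (𝓖.inv a) y h₁)) :
    𝓨.act (𝓖.inv (𝓖.mul a b hab)) y h = 𝓨.act (𝓖.inv b) (𝓨.act (𝓖.inv a) y h₁) h₂ := by
  have hb : 𝓖.s b = 𝓨.p (𝓨.act (𝓖.inv b) (𝓨.act (𝓖.inv a) y h₁) h₂) := by
    rw [𝓨.p_act, 𝓖.r_inv]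
  have key : 𝓨.act (𝓖.mul a b hab) (𝓨.act (𝓖.inv b) (𝓨.act (𝓖.inv a) y h₁) h₂)
      ((𝓖.s_mul _ _ _).trans hb) = y := by
    rw [𝓨.mul_act a b _ hab hb]
    refine (𝓨.act_congr rfl (𝓨.act_inv_act b _ h₂ hb) _ ?_).trans (𝓨.act_inv_act a y h₁ ?_)
    all_goals rw [𝓨.p_act, 𝓖.r_inv]
  refine (𝓨.act_congr rfl key.symm h ?_).trans (𝓨.inv_act_act _ _ _ ?_)
  all_goals rw [𝓨.p_act, 𝓖.s_inv]

/-- The semi-direct product groupoid `Y ⋊ 𝓖`, with set of units `Y`: its arrows are the pairs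
`(y, γ)` with `p y = r γ` (with the topology induced by `Y × G`), the range of `(y, γ)` is `y`, its
source is `γ⁻¹ y`, and `(y, γ)(γ⁻¹ y, γ₁) = (y, γ γ₁)`, `(y, γ)⁻¹ = (γ⁻¹ y, γ⁻¹)`. -/
def semidirect (𝓨 : GSpace 𝓖 Y) : GroupoidStr Y {z : Y × G // 𝓨.p z.1 = 𝓖.r z.2} where
  r z := z.1.1
  s z := 𝓨.act (𝓖.inv z.1.2) z.1.1 ((𝓖.s_inv z.1.2).trans z.2.symm)
  unit y := ⟨(y, 𝓖.unit (𝓨.p y)), (𝓖.r_unit (𝓨.p y)).symm⟩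
  mul a b h := ⟨(a.1.1, 𝓖.mul a.1.2 b.1.2 (by
      rw [← b.2, ← h, 𝓨.p_act, 𝓖.r_inv])), by rw [𝓖.r_mul]; exact a.2⟩
  inv a := ⟨(𝓨.act (𝓖.inv a.1.2) a.1.1 ((𝓖.s_inv a.1.2).trans a.2.symm), 𝓖.inv a.1.2),
    𝓨.p_act _ _ _⟩
  r_unit _ := rfl
  s_unit y := by
    have h₀ : 𝓖.s (𝓖.inv (𝓖.unit (𝓨.p y))) = 𝓨.p (𝓨.act (𝓖.unit (𝓨.p y)) y (𝓖.s_unit _)) := by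
      rw [𝓖.s_inv, 𝓨.p_act]
    exact (𝓨.act_congr rfl (𝓨.unit_act y).symm _ h₀).trans (𝓨.inv_act_act _ y (𝓖.s_unit _) h₀)
  r_mul _ _ _ := rfl
  s_mul a b h := by
    have hab : 𝓖.s a.1.2 = 𝓖.r b.1.2 := by rw [← b.2, ← h, 𝓨.p_act, 𝓖.r_inv]
    have h₁ : 𝓖.s (𝓖.inv a.1.2) = 𝓨.p a.1.1 := (𝓖.s_inv _).trans a.2.symm
    have h₂ : 𝓖.s (𝓖.inv b.1.2) = 𝓨.p (𝓨.act (𝓖.inv a.1.2) a.1.1 h₁) := by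
      rw [𝓖.s_inv, 𝓨.p_act, 𝓖.r_inv, hab]
    exact (𝓨.inv_mul_act a.1.2 b.1.2 a.1.1 hab _ h₁ h₂).trans (𝓨.act_congr rfl h _ _)
  r_inv _ := rfl
  s_inv a := by
    have h₁ : 𝓖.s (𝓖.inv a.1.2) = 𝓨.p a.1.1 := (𝓖.s_inv _).trans a.2.symm
    exact 𝓨.inv_act_act (𝓖.inv a.1.2) a.1.1 h₁ _
  mul_assoc a b c h₁ h₂ := Subtype.ext (Prod.ext rfl (𝓖.mul_assoc _ _ _ _ _))
  unit_mul a := Subtype.ext (Prod.ext rfl (by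
    have key : ∀ x (hx : 𝓖.s (𝓖.unit x) = 𝓖.r a.1.2), x = 𝓖.r a.1.2 →
        𝓖.mul (𝓖.unit x) a.1.2 hx = a.1.2 := by
      intro x hx e
      subst e
      exact 𝓖.unit_mul _
    exact key _ _ a.2))
  mul_unit a := Subtype.ext (Prod.ext rfl (by
    have key : ∀ x (hx : 𝓖.s a.1.2 = 𝓖.r (𝓖.unit x)), x = 𝓖.s a.1.2 →
        𝓖.mul a.1.2 (𝓖.unit x) hx = a.1.2 := by
      intro x hx e
      subst e
      exact 𝓖.mul_unit _
    exact key _ _ ((𝓨.p_act _ _ _).trans (𝓖.r_inv _))))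
  mul_inv a := Subtype.ext (Prod.ext rfl ((𝓖.mul_inv a.1.2).trans (congrArg 𝓖.unit a.2.symm)))
  inv_mul a := Subtype.ext (Prod.ext rfl ((𝓖.inv_mul a.1.2).trans
    (congrArg 𝓖.unit ((𝓨.p_act _ _ _).trans (𝓖.r_inv _)).symm)))

end GSpace

/-- Strong amenability at infinity: there is a `𝓖`-space `Y` whose momentum map is proper and has a
continuous section, and which is amenable, that is, `Y ⋊ 𝓖` is an amenable groupoid. -/
def IsStronglyAmenableAtInfinity [TopologicalSpace X] [TopologicalSpace G]
    (𝓖 : GroupoidStr X G) : Prop :=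
  ∃ (Y : Type w) (_ : TopologicalSpace Y) (𝓨 : GSpace 𝓖 Y),
    IsProperMap 𝓨.p ∧ 𝓨.semidirect.IsAmenable ∧
    ∃ σ : X → Y, Continuous σ ∧ ∀ x, 𝓨.p (σ x) = x

/-- Groupoid homomorphism: composable pairs are sent to composable pairs, and the product is
preserved. -/
def IsHom {W : Type v₀} {H : Type v} (𝓖 : GroupoidStr X G) (𝓗 : GroupoidStr W H)
    (ρ : G → H) : Prop :=
  ∀ a b (h : 𝓖.s a = 𝓖.r b),
    ∃ h' : 𝓗.s (ρ a) = 𝓗.r (ρ b), ρ (𝓖.mul a b h) = 𝓗.mul (ρ a) (ρ b) h'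

/-- A map `ρ` defined on `𝓖` is locally proper if `γ ↦ (r γ, ρ γ, s γ)` is a proper map. -/
def IsLocallyProper {H : Type v} [TopologicalSpace X] [TopologicalSpace G] [TopologicalSpace H]
    (𝓖 : GroupoidStr X G) (ρ : G → H) : Prop :=
  IsProperMap fun γ => (𝓖.r γ, ρ γ, 𝓖.s γ)

end GroupoidStr

/-!
Strong amenability at infinity is inherited along a locally proper homomorphism `ρ : 𝓖 → 𝓗` of
étale groupoids, for two reasons.

**The space.** Let `Y` be an amenable `𝓗`-space with proper momentum map `p` and continuous
section `σ`. The fibre product of `X` and `Y` over `ρ : X → W` and `p` is a `𝓖`-space for the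
action `γ(x, y) = (r(γ), ρ(γ)y)`; its projection to `X` is proper and has the section `x ↦ (x,
σ(ρ(x)))`. It lives in the universe of `Y`, so it is replaced by the closure of the orbit of the
section. This closure is invariant because the source map is open (`act_mem_closure`), and it has
at most as many points as there are ultrafilters on `𝓖` (`small_closure_range`), hence it can be
transported to the universe of `𝓖`. The second projection induces a proper homomorphism between
the semi-direct product groupoids (`isEtaleProperHom_semidirect`), and both of these are étale
(`GSpace.isEtale_semidirect`).

**Amenability.** It remains to see that amenability passes from the target to the source of a
proper homomorphism `ρ` of étale groupoids (`IsEtaleProperHom.isAmenable`). The fibres of the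
range map are discrete, so an approximate invariant mean is given by continuous densities on the
groupoid (`IsEtale.exists_density`, `IsEtale.isAmenable_of_density`), and on the target these
densities may be truncated to compactly supported functions `m`
(`IsEtale.exists_density_hasCompactSupport`). The groupoid `𝓖` acts properly on the space of the
pairs `(x, b)` with `ρ(x) = r(b)`. For a cutoff function `c` on this space, put `k(γ, b) =
c(γ⁻¹(r(γ), b))` and `N(x, b) = ∑_{r(γ) = x} k(γ, b)`; the function `N` is invariant. Then `η(γ) =
∑_b m(b) k(γ, b) / max(1, N(r(γ), b))` is continuous, and it is as close to being invariant as `m`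
is, since translating `η` by `γ` is the same as translating `m` by `ρ(γ)`
(`IsHom.pullDensity_ldiv`) and `m ↦ η` is a contraction for the `ℓ¹`-norms of the fibres
(`IsEtaleProperHom.fiberSum_pullDensity`). Only a compact set of units matters for a given compact
set of arrows, so it suffices that `c = 1` on a compact set, which makes `N ≥ 1` where it is
needed: no paracompactness is required. The mass missing over the other units is placed on the
units, which form a clopen set. The continuity of all the sums involved is that of sums over the
fibres of a local homeomorphism (`IsLocalHomeomorph.continuousOn_fiberSum`).
-/

/-! ### Sums over the fibres of a local homeomorphism -/

/-- The sum of `f` over the fibre of `q` over `z`. -/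
noncomputable def fiberSum {E F V : Type*} [TopologicalSpace V] [AddCommMonoid V] (q : E → F)
    (f : E → V) (z : F) : V :=
  ∑' e : {e // q e = z}, f e

section FiberSum

variable {E F T V : Type*} [TopologicalSpace E] [TopologicalSpace F] [TopologicalSpace T]
  [TopologicalSpace V]

/-- A compact set meets every fibre of a local homeomorphism in a finite set. -/
theorem IsLocalHomeomorph.finite_inter_fiber [T1Space F] {q : E → F} (hq : IsLocalHomeomorph q)
    {K : Set E} (hK : IsCompact K) (z : F) : (K ∩ q ⁻¹' {z}).Finite := by
  have hc : IsCompact (K ∩ q ⁻¹' {z}) :=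
    hK.inter_right (isClosed_singleton.preimage hq.continuous)
  refine hc.finite ?_
  refine ⟨discreteTopology_iff_isOpen_singleton.2 ?_⟩
  rintro ⟨e, he⟩
  obtain ⟨U, hU, heU, hinj⟩ := hq.isLocallyInjective e
  refine ⟨U, hU, ?_⟩
  ext ⟨e', he'⟩
  simp only [mem_preimage, mem_singleton_iff, Subtype.mk.injEq]
  refine ⟨fun h => hinj h heU (he'.2.trans he.2.symm), ?_⟩
  rintro rfl
  exact heU

/-- Near a given parameter, the fibres of a local homeomorphism meet a compact set only along
finitely many local sections, so the sum over the fibres of a family of functions with locally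
uniformly compact supports depends continuously on the parameter. -/
theorem IsLocalHomeomorph.continuousOn_fiberSum [T2Space E] [T2Space F] [AddCommMonoid V]
    [ContinuousAdd V] {q : E → F} (hq : IsLocalHomeomorph q) {A : Set T} {g : T → F}
    (hg : ContinuousOn g A) {f : E → T → V}
    (hf : ContinuousOn (fun p : E × T => f p.1 p.2) {p | p.2 ∈ A ∧ q p.1 = g p.2})
    (hs : ∀ t₀ ∈ A, ∃ K : Set E, IsCompact K ∧
      ∀ᶠ t in 𝓝[A] t₀, ∀ e, q e = g t → f e t ≠ 0 → e ∈ K) :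
    ContinuousOn (fun t => fiberSum q (fun e => f e t) (g t)) A := by
  classical
  intro t₀ ht₀
  obtain ⟨K, hK, hKs⟩ := hs t₀ ht₀
  have hfin := hq.finite_inter_fiber hK (g t₀)
  set S : Finset E := hfin.toFinset
  have hSq : ∀ e ∈ S, q e = g t₀ := fun e he => ((hfin.mem_toFinset).1 he).2
  obtain ⟨U, hU, hUd⟩ := hfin.t2_separation
  choose φ hφs hφq using fun e => hq e
  -- the open set on which the local section through `e` stays in the neighbourhood `U e`
  let O : E → Set E := fun e => U e ∩ (φ e).source
  have hO : ∀ e, IsOpen (O e) := fun e => (hU e).2.inter (φ e).open_source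
  have heO : ∀ e, e ∈ O e := fun e => ⟨(hU e).1, hφs e⟩
  have hgt : Tendsto g (𝓝[A] t₀) (𝓝 (g t₀)) := hg t₀ ht₀
  have hsec : ∀ e ∈ S, Tendsto (fun t => (φ e).symm (g t)) (𝓝[A] t₀) (𝓝 e) := by
    intro e he
    have h1 : Tendsto (φ e).symm (𝓝 (φ e e)) (𝓝 e) := (φ e).tendsto_symm (hφs e)
    rw [← hφq e, hSq e he] at h1
    exact h1.comp hgt
  have hqsec : ∀ e ∈ S, ∀ᶠ t in 𝓝[A] t₀, q ((φ e).symm (g t)) = g t := by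
    intro e he
    have h1 : (φ e).target ∈ 𝓝 (g t₀) := by
      rw [← hSq e he, hφq e]; exact (φ e).open_target.mem_nhds ((φ e).map_source (hφs e))
    filter_upwards [hgt h1] with t ht
    rw [hφq e]; exact (φ e).right_inv ht
  have hsecO : ∀ e ∈ S, ∀ᶠ t in 𝓝[A] t₀, (φ e).symm (g t) ∈ O e :=
    fun e he => hsec e he ((hO e).mem_nhds (heO e))
  have hrest : ∀ᶠ t in 𝓝[A] t₀, ∀ e ∈ K, q e = g t → e ∈ ⋃ e' ∈ S, O e' := by
    have hKc : IsCompact (K \ ⋃ e' ∈ S, O e') :=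
      hK.diff (isOpen_biUnion fun e _ => hO e)
    have hcl : IsClosed (q '' (K \ ⋃ e' ∈ S, O e')) := (hKc.image hq.continuous).isClosed
    have hn : g t₀ ∉ q '' (K \ ⋃ e' ∈ S, O e') := by
      rintro ⟨e, ⟨heK, heU⟩, he⟩
      exact heU (mem_biUnion ((hfin.mem_toFinset).2 ⟨heK, he⟩) (heO e))
    filter_upwards [hgt (hcl.isOpen_compl.mem_nhds hn)] with t ht e heK he
    by_contra hne
    exact ht ⟨e, ⟨heK, hne⟩, he⟩
  have hformula : ∀ᶠ t in 𝓝[A] t₀,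
      fiberSum q (fun e => f e t) (g t) = ∑ e ∈ S, f ((φ e).symm (g t)) t := by
    filter_upwards [hKs, hrest, (S.eventually_all).2 hqsec, (S.eventually_all).2 hsecO]
      with t h1 h2 h3 h4
    have h5 : ∀ e ∈ S, ∀ e' ∈ S, (φ e).symm (g t) = (φ e').symm (g t) → e = e' := by
      intro e he e' he' hee
      by_contra hne
      have := hUd ((hfin.mem_toFinset).1 he) ((hfin.mem_toFinset).1 he') hne
      exact this.le_bot ⟨(h4 e he).1, hee ▸ (h4 e' he').1⟩
    refine (tsum_subtype {e | q e = g t} fun e => f e t).trans ?_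
    rw [tsum_eq_sum (s := S.image fun e => (φ e).symm (g t)), Finset.sum_image h5]
    · refine Finset.sum_congr rfl fun e he => ?_
      rw [indicator_of_mem]
      exact h3 e he
    · intro e he
      by_contra hne
      have hmem : e ∈ {e | q e = g t} := by
        by_contra h; exact hne (indicator_of_notMem h _)
      rw [indicator_of_mem hmem] at hne
      obtain ⟨e', he', hee'⟩ := mem_iUnion₂.1 (h2 e (h1 e hmem hne) hmem)
      refine he (Finset.mem_image.2 ⟨e', he', ?_⟩)
      have : φ e' e = g t := by rw [← hφq e']; exact hmem
      rw [← this]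
      exact (φ e').left_inv hee'.2
  have hform0 : fiberSum q (fun e => f e t₀) (g t₀) = ∑ e ∈ S, f ((φ e).symm (g t₀)) t₀ :=
    hformula.self_of_nhdsWithin ht₀
  refine Tendsto.congr' (hformula.mono fun t h => h.symm) ?_
  change Tendsto _ _ (𝓝 (fiberSum q (fun e => f e t₀) (g t₀)))
  rw [hform0]
  refine tendsto_finsetSum _ fun e he => ?_
  have he0 : (φ e).symm (g t₀) = e := by
    rw [← hSq e he, hφq e]; exact (φ e).left_inv (hφs e)
  rw [he0]
  have hmem : (e, t₀) ∈ {p : E × T | p.2 ∈ A ∧ q p.1 = g p.2} := ⟨ht₀, hSq e he⟩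
  refine (hf _ hmem).tendsto.comp (f := fun t => ((φ e).symm (g t), t)) ?_
  refine tendsto_nhdsWithin_iff.2 ⟨?_, ?_⟩
  · exact (hsec e he).prodMk_nhds (tendsto_id.mono_left nhdsWithin_le_nhds)
  · filter_upwards [hqsec e he, self_mem_nhdsWithin] with t h1 h2
    exact ⟨h2, h1⟩

/-- The unparametrised case of `IsLocalHomeomorph.continuousOn_fiberSum`. -/
theorem IsLocalHomeomorph.continuous_fiberSum [T2Space E] [T2Space F] [AddCommMonoid V]
    [ContinuousAdd V] {q : E → F} (hq : IsLocalHomeomorph q) {f : E → V} (hf : Continuous f)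
    (hs : ∀ z₀, ∃ K : Set E, IsCompact K ∧ ∀ᶠ z in 𝓝 z₀, ∀ e, q e = z → f e ≠ 0 → e ∈ K) :
    Continuous (fiberSum q f) := by
  rw [← continuousOn_univ]
  refine hq.continuousOn_fiberSum (g := id) (f := fun e _ => f e) continuousOn_id
    (by fun_prop) fun z _ => ?_
  simpa using hs z

end FiberSum

/-- A compactly supported function on the total space of a local homeomorphism has finite support on
each fibre. -/
theorem IsLocalHomeomorph.finite_support_fiber {E F V : Type*} [TopologicalSpace E]
    [TopologicalSpace F] [T1Space F] [Zero V] {q : E → F}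
    (hq : IsLocalHomeomorph q) {f : E → V} {K : Set E} (hK : IsCompact K) (z : F)
    (hf : ∀ e, q e = z → f e ≠ 0 → e ∈ K) :
    (Function.support fun e : {e // q e = z} => f e).Finite := by
  refine Set.Finite.of_finite_image (f := Subtype.val) ((hq.finite_inter_fiber hK z).subset ?_)
    Subtype.val_injective.injOn
  rintro _ ⟨e, he, rfl⟩
  exact ⟨hf e e.2 he, e.2⟩

/-- Fubini for a kernel whose support has finite fibres over finitely many points. -/
theorem tsum_comm_of_finite {α β : Type*} {F : α → β → ℝ} {Q : Set β} (hQ : Q.Finite)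
    (hF : ∀ a b, F a b ≠ 0 → b ∈ Q) (hb : ∀ b ∈ Q, (Function.support fun a => F a b).Finite) :
    ∑' a, ∑' b, F a b = ∑' b, ∑' a, F a b := by
  refine (Summable.tsum_comm (summable_of_hasFiniteSupport ?_)).symm
  refine (hQ.biUnion fun b hbQ => (hb b hbQ).image fun a => (a, b)).subset ?_
  rintro ⟨a, b⟩ h
  exact mem_biUnion (hF a b h) ⟨a, h, rfl⟩

/-! ### Left division in a groupoid, homomorphisms and étale groupoids -/

namespace GroupoidStr

section Algebra

variable {X G W H : Type*} (𝓖 : GroupoidStr X G) (𝓗 : GroupoidStr W H)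

theorem mul_congr {a a' b b' : G} (ha : a = a') (hb : b = b') (h : 𝓖.s a = 𝓖.r b)
    (h' : 𝓖.s a' = 𝓖.r b') : 𝓖.mul a b h = 𝓖.mul a' b' h' := by
  subst ha hb
  rfl

open Classical in
/-- The left quotient `a⁻¹ b` of two arrows with the same range, extended by `b` to all pairs. -/
noncomputable def ldiv (a b : G) : G :=
  if h : 𝓖.r a = 𝓖.r b then 𝓖.mul (𝓖.inv a) b ((𝓖.s_inv a).trans h) else b

variable {𝓖 𝓗}

theorem ldiv_of_eq {a b : G} (h : 𝓖.r a = 𝓖.r b) :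
    𝓖.ldiv a b = 𝓖.mul (𝓖.inv a) b ((𝓖.s_inv a).trans h) :=
  dif_pos h

theorem r_ldiv {a b : G} (h : 𝓖.r a = 𝓖.r b) : 𝓖.r (𝓖.ldiv a b) = 𝓖.s a := by
  rw [ldiv_of_eq h, 𝓖.r_mul, 𝓖.r_inv]

theorem s_ldiv (a b : G) : 𝓖.s (𝓖.ldiv a b) = 𝓖.s b := by
  unfold ldiv
  split_ifs with h
  · exact 𝓖.s_mul _ _ _
  · rfl

theorem ldiv_mul {a c : G} (h : 𝓖.s a = 𝓖.r c) : 𝓖.ldiv a (𝓖.mul a c h) = c := by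
  have h' : 𝓖.r a = 𝓖.r (𝓖.mul a c h) := (𝓖.r_mul _ _ _).symm
  rw [ldiv_of_eq h', ← 𝓖.mul_assoc (𝓖.inv a) a c (𝓖.s_inv a) h]
  have e : 𝓖.mul (𝓖.inv a) a (𝓖.s_inv a) = 𝓖.unit (𝓖.r c) := by rw [𝓖.inv_mul, h]
  exact (𝓖.mul_congr e rfl _ (𝓖.s_unit _)).trans (𝓖.unit_mul c)

theorem mul_ldiv {a b : G} (h : 𝓖.r a = 𝓖.r b) :
    𝓖.mul a (𝓖.ldiv a b) (r_ldiv h).symm = b := by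
  rw [𝓖.mul_congr rfl (ldiv_of_eq h) _ (by rw [𝓖.r_mul, 𝓖.r_inv]),
    ← 𝓖.mul_assoc a (𝓖.inv a) b (𝓖.r_inv a).symm ((𝓖.s_inv a).trans h)]
  have e : 𝓖.mul a (𝓖.inv a) (𝓖.r_inv a).symm = 𝓖.unit (𝓖.r b) := by rw [𝓖.mul_inv, h]
  exact (𝓖.mul_congr e rfl _ (𝓖.s_unit _)).trans (𝓖.unit_mul b)

theorem ldiv_ldiv {a b c : G} (hb : 𝓖.r a = 𝓖.r b) (hc : 𝓖.r a = 𝓖.r c) :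
    𝓖.ldiv (𝓖.ldiv a b) (𝓖.ldiv a c) = 𝓖.ldiv b c := by
  have hbc : 𝓖.r b = 𝓖.r c := hb.symm.trans hc
  have h1 : 𝓖.s (𝓖.ldiv a b) = 𝓖.r (𝓖.ldiv b c) := (s_ldiv a b).trans (r_ldiv hbc).symm
  have key : 𝓖.ldiv a c = 𝓖.mul (𝓖.ldiv a b) (𝓖.ldiv b c) h1 := by
    rw [𝓖.mul_congr (ldiv_of_eq hb) rfl h1 ((𝓖.s_mul _ _ _).trans (r_ldiv hbc).symm),
      𝓖.mul_assoc (𝓖.inv a) b (𝓖.ldiv b c) ((𝓖.s_inv a).trans hb) (r_ldiv hbc).symm, ldiv_of_eq hc]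
    exact 𝓖.mul_congr rfl (mul_ldiv hbc).symm _ _
  rw [key, ldiv_mul]

theorem ldiv_unit (b : G) : 𝓖.ldiv (𝓖.unit (𝓖.r b)) b = b := by
  have := ldiv_mul (𝓖 := 𝓖) (𝓖.s_unit (𝓖.r b))
  rwa [𝓖.unit_mul] at this

theorem ldiv_self (a : G) : 𝓖.ldiv a a = 𝓖.unit (𝓖.s a) := by
  rw [ldiv_of_eq rfl, 𝓖.inv_mul]

theorem eq_inv_of_mul_eq_unit {a b : G} (h : 𝓖.s a = 𝓖.r b)
    (hab : 𝓖.mul a b h = 𝓖.unit (𝓖.r a)) : b = 𝓖.inv a := by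
  rw [← ldiv_mul h, hab, ldiv_of_eq (𝓖.r_unit _).symm]
  refine (𝓖.mul_congr rfl ?_ _ (𝓖.r_unit _).symm).trans (𝓖.mul_unit (𝓖.inv a))
  rw [𝓖.s_inv]

theorem inv_inv (a : G) : 𝓖.inv (𝓖.inv a) = a :=
  (eq_inv_of_mul_eq_unit (𝓖.s_inv a) ((𝓖.inv_mul a).trans (by rw [𝓖.r_inv]))).symm

/-- Left division by `a` is a bijection from the fibre over `r a` onto the fibre over `s a`, with
inverse the left translation by `a`. -/
noncomputable def ldivEquiv (𝓖 : GroupoidStr X G) (a : G) :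
    {b // 𝓖.r b = 𝓖.r a} ≃ {c // 𝓖.r c = 𝓖.s a} where
  toFun b := ⟨𝓖.ldiv a b, r_ldiv b.2.symm⟩
  invFun c := ⟨𝓖.mul a c c.2.symm, 𝓖.r_mul _ _ _⟩
  left_inv b := Subtype.ext (mul_ldiv b.2.symm)
  right_inv c := Subtype.ext (ldiv_mul c.2.symm)

theorem fiberSum_ldiv {V : Type*} [TopologicalSpace V] [AddCommMonoid V] (a : G) (f : G → V) :
    fiberSum 𝓖.r (fun b => f (𝓖.ldiv a b)) (𝓖.r a) = fiberSum 𝓖.r f (𝓖.s a) :=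
  (𝓖.ldivEquiv a).tsum_eq fun c => f c

namespace IsHom

variable {ρ : G → H}

/-- The map induced by a homomorphism on the sets of units. -/
def unitMap (𝓖 : GroupoidStr X G) (𝓗 : GroupoidStr W H) (ρ : G → H) (x : X) : W :=
  𝓗.r (ρ (𝓖.unit x))

theorem map_unit (hρ : 𝓖.IsHom 𝓗 ρ) (x : X) :
    ρ (𝓖.unit x) = 𝓗.unit (unitMap 𝓖 𝓗 ρ x) := by
  obtain ⟨h, e⟩ := hρ (𝓖.unit x) (𝓖.unit x) (by rw [𝓖.s_unit, 𝓖.r_unit])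
  have e' : 𝓖.mul (𝓖.unit x) (𝓖.unit x) (by rw [𝓖.s_unit, 𝓖.r_unit]) = 𝓖.unit x :=
    (𝓖.mul_congr (by rw [𝓖.r_unit]) rfl _ (𝓖.s_unit _)).trans (𝓖.unit_mul (𝓖.unit x))
  rw [e'] at e
  have := ldiv_mul h
  rw [← e, ldiv_self] at this
  rw [← this, h]
  rfl

theorem r_map (hρ : 𝓖.IsHom 𝓗 ρ) (a : G) : 𝓗.r (ρ a) = unitMap 𝓖 𝓗 ρ (𝓖.r a) := by
  obtain ⟨h, -⟩ := hρ (𝓖.unit (𝓖.r a)) a (𝓖.s_unit _)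
  rw [← h, hρ.map_unit, 𝓗.s_unit]

theorem s_map (hρ : 𝓖.IsHom 𝓗 ρ) (a : G) : 𝓗.s (ρ a) = unitMap 𝓖 𝓗 ρ (𝓖.s a) := by
  obtain ⟨h, -⟩ := hρ a (𝓖.unit (𝓖.s a)) (𝓖.r_unit _).symm
  rw [h, hρ.map_unit, 𝓗.r_unit]

theorem map_inv (hρ : 𝓖.IsHom 𝓗 ρ) (a : G) : ρ (𝓖.inv a) = 𝓗.inv (ρ a) := by
  obtain ⟨h, e⟩ := hρ a (𝓖.inv a) (𝓖.r_inv a).symm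
  refine eq_inv_of_mul_eq_unit h ?_
  rw [← e, 𝓖.mul_inv, hρ.map_unit, hρ.r_map]

theorem map_ldiv (hρ : 𝓖.IsHom 𝓗 ρ) {a b : G} (h : 𝓖.r a = 𝓖.r b) :
    ρ (𝓖.ldiv a b) = 𝓗.ldiv (ρ a) (ρ b) := by
  obtain ⟨h', e⟩ := hρ (𝓖.inv a) b ((𝓖.s_inv a).trans h)
  rw [ldiv_of_eq h, e, ldiv_of_eq (by rw [hρ.r_map, hρ.r_map, h])]
  exact 𝓗.mul_congr (hρ.map_inv a) rfl _ _

end IsHom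

end Algebra

section Topology

variable {X G W H : Type*} {𝓖 : GroupoidStr X G} {𝓗 : GroupoidStr W H}
  [TopologicalSpace X] [TopologicalSpace G] [TopologicalSpace W] [TopologicalSpace H]

namespace IsLocallyCompactGroupoid

theorem isEmbedding_unit (h : 𝓖.IsLocallyCompactGroupoid) : IsEmbedding 𝓖.unit :=
  Function.LeftInverse.isEmbedding 𝓖.r_unit h.continuous_r h.continuous_unit

theorem t2Space_units (h : 𝓖.IsLocallyCompactGroupoid) : T2Space X :=
  have := h.t2Space
  h.isEmbedding_unit.t2Space

theorem continuousOn_mul (h : 𝓖.IsLocallyCompactGroupoid) {T : Type*} [TopologicalSpace T]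
    {A : Set T} {a b : T → G} (ha : ContinuousOn a A) (hb : ContinuousOn b A)
    (hab : ∀ t ∈ A, 𝓖.s (a t) = 𝓖.r (b t)) {f : T → G}
    (hf : ∀ t (ht : t ∈ A), f t = 𝓖.mul (a t) (b t) (hab t ht)) : ContinuousOn f A := by
  rw [continuousOn_iff_continuous_domRestrict] at *
  have : A.domRestrict f = (fun z : {z : G × G // 𝓖.s z.1 = 𝓖.r z.2} => 𝓖.mul z.1.1 z.1.2 z.2) ∘
      fun t : A => ⟨(a t, b t), hab t t.2⟩ := by
    ext t
    exact hf t t.2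
  rw [this]
  exact h.continuous_mul.comp ((ha.prodMk hb).subtype_mk _)

theorem continuousOn_ldiv (h : 𝓖.IsLocallyCompactGroupoid) :
    ContinuousOn (fun p : G × G => 𝓖.ldiv p.1 p.2) {p | 𝓖.r p.1 = 𝓖.r p.2} :=
  h.continuousOn_mul (a := fun p : G × G => 𝓖.inv p.1)
    (b := fun p : G × G => p.2)
    (h.continuous_inv.comp continuous_fst).continuousOn continuous_snd.continuousOn
    (fun _ hp => (𝓖.s_inv _).trans hp) fun _ hp => ldiv_of_eq hp

/-- The set of products `a b` with `a` and `b` in compact sets is contained in a compact set. -/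
theorem exists_isCompact_mul (h : 𝓖.IsLocallyCompactGroupoid) {K L : Set G} (hK : IsCompact K)
    (hL : IsCompact L) : ∃ M : Set G, IsCompact M ∧
      ∀ a ∈ K, ∀ b ∈ L, ∀ hab : 𝓖.s a = 𝓖.r b, 𝓖.mul a b hab ∈ M := by
  have := h.t2Space_units
  have hcl : IsClosed {z : G × G | 𝓖.s z.1 = 𝓖.r z.2} :=
    isClosed_eq (h.continuous_s.comp continuous_fst) (h.continuous_r.comp continuous_snd)
  have hc : IsCompact ((Subtype.val : {z : G × G | 𝓖.s z.1 = 𝓖.r z.2} → G × G) ⁻¹' (K ×ˢ L)) :=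
    hcl.isClosedEmbedding_subtypeVal.isCompact_preimage (hK.prod hL)
  exact ⟨_, hc.image h.continuous_mul, fun a ha b hb hab => ⟨⟨(a, b), hab⟩, ⟨ha, hb⟩, rfl⟩⟩

/-- If `b` and `a⁻¹ b` lie in compact sets, then so does `a`. -/
theorem exists_isCompact_of_ldiv (h : 𝓖.IsLocallyCompactGroupoid) {K L : Set G} (hK : IsCompact K)
    (hL : IsCompact L) : ∃ M : Set G, IsCompact M ∧
      ∀ a b, 𝓖.r a = 𝓖.r b → b ∈ K → 𝓖.ldiv a b ∈ L → a ∈ M := by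
  obtain ⟨M, hM, hMm⟩ := h.exists_isCompact_mul hK (hL.image h.continuous_inv)
  refine ⟨M, hM, fun a b hab hb hl => ?_⟩
  have h1 : 𝓖.s b = 𝓖.r (𝓖.inv (𝓖.ldiv a b)) := by rw [𝓖.r_inv, s_ldiv]
  have e : 𝓖.mul b (𝓖.inv (𝓖.ldiv a b)) h1 = a := by
    have h2 : 𝓖.mul a (𝓖.ldiv a b) (r_ldiv hab).symm = b := mul_ldiv hab
    rw [𝓖.mul_congr h2.symm rfl h1 (by rw [𝓖.s_mul, 𝓖.r_inv]),
      𝓖.mul_assoc _ _ _ (r_ldiv hab).symm (𝓖.r_inv _).symm]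
    refine (𝓖.mul_congr rfl ?_ _ (𝓖.r_unit _).symm).trans (𝓖.mul_unit a)
    rw [𝓖.mul_inv, r_ldiv hab]
  rw [← e]
  exact hMm b hb _ (mem_image_of_mem _ hl) h1

theorem isOpenMap_s (h : 𝓖.IsLocallyCompactGroupoid) : IsOpenMap 𝓖.s := by
  have e : 𝓖.s = 𝓖.r ∘ 𝓖.inv := funext fun a => (𝓖.r_inv a).symm
  rw [e]
  exact h.isOpenMap_r.comp
    (Homeomorph.mk ⟨𝓖.inv, 𝓖.inv, inv_inv, inv_inv⟩ h.continuous_inv h.continuous_inv).isOpenMap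

end IsLocallyCompactGroupoid

namespace IsEtale

theorem isOpenEmbedding_unit (h : 𝓖.IsEtale) : IsOpenEmbedding 𝓖.unit := by
  refine h.isLocalHomeomorph_r.isOpenEmbedding_of_comp ?_ h.continuous_unit
  have : 𝓖.r ∘ 𝓖.unit = id := funext 𝓖.r_unit
  rw [this]
  exact IsOpenEmbedding.id

theorem locallyCompactSpace_units (h : 𝓖.IsEtale) : LocallyCompactSpace X :=
  have := h.locallyCompactSpace
  h.isOpenEmbedding_unit.locallyCompactSpace

/-- The units of an étale groupoid form a clopen set of arrows. -/
theorem isClopen_range_unit (h : 𝓖.IsEtale) : IsClopen (range 𝓖.unit) := by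
  have := h.t2Space
  refine ⟨?_, h.isOpenEmbedding_unit.isOpen_range⟩
  have e : range 𝓖.unit = {a | 𝓖.unit (𝓖.r a) = a} := by
    ext a
    refine ⟨?_, fun ha => ⟨_, ha⟩⟩
    rintro ⟨x, rfl⟩
    rw [mem_ofPred_eq, 𝓖.r_unit]
  rw [e]
  exact isClosed_eq (h.continuous_unit.comp h.continuous_r) continuous_id

theorem discreteTopology_fiber (h : 𝓖.IsEtale) (x : X) : DiscreteTopology (𝓖.Fiber x) := by
  refine discreteTopology_iff_isOpen_singleton.2 ?_
  rintro ⟨e, he⟩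
  obtain ⟨U, hU, heU, hinj⟩ := h.isLocalHomeomorph_r.isLocallyInjective e
  refine ⟨U, hU, ?_⟩
  ext ⟨e', he'⟩
  refine ⟨fun h' => Subtype.ext (hinj h' heU (he'.trans he.symm)), ?_⟩
  rintro h'
  obtain rfl : e' = e := congrArg Subtype.val h'
  exact heU

end IsEtale

theorem IsHom.continuous_unitMap (h𝓖 : 𝓖.IsLocallyCompactGroupoid)
    (h𝓗 : 𝓗.IsLocallyCompactGroupoid) {ρ : G → H} (hρ : Continuous ρ) :
    Continuous (IsHom.unitMap 𝓖 𝓗 ρ) :=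
  h𝓗.continuous_r.comp (hρ.comp h𝓖.continuous_unit)

end Topology

end GroupoidStr

/-! ### Measures on discrete fibres and their densities -/

section DiscreteMeasure

variable {α : Type*} [MeasurableSpace α]

theorem MeasureTheory.SignedMeasure.sum_abs_singleton_le [MeasurableSingletonClass α]
    (ν : SignedMeasure α) (F : Finset α) :
    ∑ a ∈ F, |ν {a}| ≤ ν.totalVariation.real univ := calc
  ∑ a ∈ F, |ν {a}| ≤ ∑ a ∈ F, ν.totalVariation.real {a} :=
    Finset.sum_le_sum fun a _ => ν.norm_le_totalVariation {a}
  _ = ν.totalVariation.real F := sum_measureReal_singleton F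
  _ ≤ ν.totalVariation.real univ := measureReal_mono (subset_univ _)

/-- The total variation of the difference of two measures concentrated on a finite set `F` is the
`ℓ¹`-norm of the difference of their densities; only an upper bound is recorded. -/
theorem MeasureTheory.totalVariation_sub_le_sum [MeasurableSingletonClass α] (μ ν : Measure α)
    [IsFiniteMeasure μ] [IsFiniteMeasure ν] (F : Finset α) (hμ : μ (F : Set α)ᶜ = 0)
    (hν : ν (F : Set α)ᶜ = 0) :
    (μ.toSignedMeasure - ν.toSignedMeasure).totalVariation.real univ ≤
      ∑ a ∈ F, |μ.real {a} - ν.real {a}| := by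
  classical
  set ξ := μ.toSignedMeasure - ν.toSignedMeasure with hξ
  have hfin : ∀ (κ : Measure α) [IsFiniteMeasure κ], κ (F : Set α)ᶜ = 0 → ∀ s : Set α,
      κ.real s = ∑ a ∈ F with a ∈ s, κ.real {a} := by
    intro κ _ hκ s
    rw [sum_measureReal_singleton]
    refine measureReal_congr ?_
    have h0 : ∀ᵐ a ∂κ, a ∈ (F : Set α) := by
      rw [ae_iff]; exact hκ
    filter_upwards [h0] with a ha
    have ha' : a ∈ F := ha
    refine propext ⟨fun h => ?_, fun h => ?_⟩
    · exact Finset.mem_coe.2 (Finset.mem_filter.2 ⟨ha', h⟩)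
    · exact (Finset.mem_filter.1 (Finset.mem_coe.1 h)).2
  have hval : ∀ s : Set α, MeasurableSet s →
      ξ s = ∑ a ∈ F with a ∈ s, (μ.real {a} - ν.real {a}) := by
    intro s hs
    rw [hξ, Measure.toSignedMeasure_sub_apply hs, hfin μ hμ, hfin ν hν, Finset.sum_sub_distrib]
  obtain ⟨i, hi, hpos, hneg, h1, h2⟩ := ξ.toJordanDecomposition_spec
  have e1 : ξ.toJordanDecomposition.posPart.real univ = ξ i := by
    rw [h1, measureReal_def, SignedMeasure.toMeasureOfZeroLE_apply _ hpos hi MeasurableSet.univ]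
    simp
  have e2 : ξ.toJordanDecomposition.negPart.real univ = -ξ iᶜ := by
    rw [h2, measureReal_def,
      SignedMeasure.toMeasureOfLEZero_apply _ hneg hi.compl MeasurableSet.univ]
    simp
  rw [SignedMeasure.totalVariation, measureReal_add_apply, e1, e2, hval i hi,
    show ξ iᶜ = ∑ a ∈ F with a ∉ i, (μ.real {a} - ν.real {a}) by
      simp only [hval iᶜ hi.compl, mem_compl_iff],
    ← Finset.sum_filter_add_sum_filter_not F (· ∈ i) fun a => |μ.real {a} - ν.real {a}|,
    ← Finset.sum_neg_distrib]
  exact add_le_add (Finset.sum_le_sum fun a _ => le_abs_self _)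
    (Finset.sum_le_sum fun a _ => neg_le_abs (μ.real {a} - ν.real {a}))

theorem MeasureTheory.integral_eq_of_forall_ne_eq_zero [MeasurableSingletonClass α]
    (μ : Measure α) [IsFiniteMeasure μ] {a : α} {f : α → ℂ} (h : ∀ c, c ≠ a → f c = 0) :
    ∫ c, f c ∂μ = (μ.real {a} : ℂ) * f a := by
  have e : f = ({a} : Set α).indicator fun _ => f a := by
    funext c
    by_cases hc : c = a
    · rw [hc, indicator_of_mem (mem_singleton a)]
    · rw [indicator_of_notMem (by simpa using hc), h c hc]
  rw [e, integral_indicator (measurableSet_singleton _), setIntegral_const, Complex.real_smul,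
    indicator_of_mem (mem_singleton a)]

/-- The measure with density `w` (or rather its positive part) with respect to the counting
measure. -/
noncomputable def atomicMeasure (w : α → ℝ) : Measure α :=
  Measure.sum fun a => ENNReal.ofReal (w a) • Measure.dirac a

theorem atomicMeasure_singleton [MeasurableSingletonClass α] (w : α → ℝ) (a : α) :
    atomicMeasure w {a} = ENNReal.ofReal (w a) :=
  Measure.sum_smul_dirac_singleton

theorem atomicMeasure_real_singleton [MeasurableSingletonClass α] {w : α → ℝ} {a : α}
    (h : 0 ≤ w a) : (atomicMeasure w).real {a} = w a := by
  rw [measureReal_def, atomicMeasure_singleton, ENNReal.toReal_ofReal h]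

theorem atomicMeasure_compl_eq_zero [MeasurableSingletonClass α] {w : α → ℝ} {F : Finset α}
    (h : ∀ a ∉ F, w a = 0) : atomicMeasure w (F : Set α)ᶜ = 0 := by
  rw [atomicMeasure, Measure.sum_apply _ F.measurableSet.compl]
  refine ENNReal.tsum_eq_zero.2 fun a => ?_
  by_cases ha : a ∈ F
  · simp [ha]
  · simp [h a ha]

theorem isProbabilityMeasure_atomicMeasure {w : α → ℝ} (h0 : ∀ a, 0 ≤ w a)
    (h1 : HasSum w 1) : IsProbabilityMeasure (atomicMeasure w) := by
  refine ⟨?_⟩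
  rw [atomicMeasure, Measure.sum_apply _ MeasurableSet.univ]
  simp only [Measure.smul_apply, measure_univ, smul_eq_mul, mul_one]
  rw [← ENNReal.ofReal_tsum_of_nonneg h0 h1.summable, h1.tsum_eq, ENNReal.ofReal_one]

theorem integral_atomicMeasure {w : α → ℝ} (h0 : ∀ a, 0 ≤ w a)
    (hfin : (Function.support w).Finite) [MeasurableSingletonClass α] (f : α → ℂ) :
    ∫ a, f a ∂atomicMeasure w = ∑' a, (w a : ℂ) * f a := by
  have hw : ∀ a ∉ hfin.toFinset, w a = 0 := fun a ha => by simpa using ha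
  have e : atomicMeasure w =
      ∑ a ∈ hfin.toFinset, ENNReal.ofReal (w a) • Measure.dirac a := by
    ext s hs
    rw [atomicMeasure, Measure.sum_apply _ hs, Measure.finsetSum_apply,
      tsum_eq_sum fun a ha => by rw [hw a ha]; simp]
  rw [e, integral_finsetSum_measure, tsum_eq_sum fun a ha => by rw [hw a ha]; simp]
  · refine Finset.sum_congr rfl fun a _ => ?_
    rw [integral_smul_measure, integral_dirac, ENNReal.toReal_ofReal (h0 a), Complex.real_smul]
  · exact fun a _ => (integrable_dirac (by finiteness)).smul_measure ENNReal.ofReal_ne_top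

theorem regular_atomicMeasure [TopologicalSpace α] [DiscreteTopology α] [BorelSpace α]
    (w : α → ℝ) [IsFiniteMeasure (atomicMeasure w)] : (atomicMeasure w).Regular := by
  have hd : ∀ a : α, (Measure.dirac a).InnerRegular := fun a => ⟨fun s hs r hr => by
    by_cases ha : a ∈ s
    · refine ⟨{a}, singleton_subset_iff.2 ha, isCompact_singleton, ?_⟩
      rwa [Measure.dirac_apply_of_mem (mem_singleton a), ← Measure.dirac_apply_of_mem ha]
    · rw [Measure.dirac_apply, indicator_of_notMem ha] at hr
      exact absurd hr (not_lt.2 bot_le)⟩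
  have : (atomicMeasure w).InnerRegular := by
    unfold atomicMeasure; infer_instance
  exact
    { lt_top_of_isCompact := fun K _ => measure_lt_top _ K
      outerRegular := fun A _ r hr => ⟨A, Subset.rfl, isOpen_discrete A, hr⟩
      innerRegular := fun U _ r hr => this.innerRegular (isOpen_discrete U).measurableSet r hr }

end DiscreteMeasure

namespace GroupoidStr

section

variable {X : Type*} {G : Type*} {𝓖 : GroupoidStr X G}

theorem translationDefect_nonneg [TopologicalSpace G] (m : (x : X) → ProbabilityMeasure (𝓖.Fiber x)) (γ : G) :
    0 ≤ 𝓖.translationDefect m γ :=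
  measureReal_nonneg

theorem translate_preimage_singleton (γ : G) (b : 𝓖.Fiber (𝓖.r γ)) :
    𝓖.translate γ ⁻¹' {b} = {⟨𝓖.ldiv γ b.1, r_ldiv b.2.symm⟩} := by
  ext c
  refine ⟨fun h => Subtype.ext ?_, fun h => Subtype.ext ?_⟩
  · obtain rfl : 𝓖.translate γ c = b := h
    exact (ldiv_mul c.2.symm).symm
  · obtain rfl := h
    exact mul_ldiv b.2.symm

variable [TopologicalSpace X] [TopologicalSpace G]

theorem IsEtale.measurable_translate (h : 𝓖.IsEtale) (γ : G) :
    Measurable (𝓖.translate γ) := by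
  have := h.discreteTopology_fiber (𝓖.s γ)
  exact continuous_of_discreteTopology.measurable

theorem IsEtale.map_translate_singleton (h : 𝓖.IsEtale) (γ : G)
    (μ : Measure (𝓖.Fiber (𝓖.s γ))) (b : 𝓖.Fiber (𝓖.r γ)) :
    (μ.map (𝓖.translate γ)).real {b} = μ.real {⟨𝓖.ldiv γ b.1, r_ldiv b.2.symm⟩} := by
  have := h.discreteTopology_fiber (𝓖.r γ)
  rw [map_measureReal_apply (h.measurable_translate γ) (measurableSet_singleton b),
    translate_preimage_singleton]

end

/-- A sufficient condition for the amenability of an étale groupoid, in terms of the densities of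
the measures with respect to the counting measures of the fibres. -/
theorem IsEtale.isAmenable_of_density {X : Type*} {G : Type*} {𝓖 : GroupoidStr X G}
    [TopologicalSpace X] [TopologicalSpace G] (h : 𝓖.IsEtale)
    (H : ∀ K : Set G, IsCompact K → ∀ ε > 0, ∃ η : G → ℝ, Continuous η ∧ (∀ a, 0 ≤ η a) ∧
      (∀ x, (Function.support fun b : {b // 𝓖.r b = x} => η b).Finite) ∧
      (∀ x, fiberSum 𝓖.r η x = 1) ∧
      ∀ γ ∈ K, fiberSum 𝓖.r (fun b => |η (𝓖.ldiv γ b) - η b|) (𝓖.r γ) ≤ ε) :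
    𝓖.IsAmenable := by
  classical
  have hT2 := h.t2Space
  have hX := h.t2Space_units
  choose! η hηc hη0 hηf hη1 hηd using H
  let θ : TopologicalSpace.Compacts G × ℕ → G → ℝ := fun i => η i.1 (1 / (i.2 + 1))
  have hK : ∀ i : TopologicalSpace.Compacts G × ℕ, IsCompact (i.1 : Set G) := fun i => i.1.isCompact
  have hε : ∀ i : TopologicalSpace.Compacts G × ℕ, (0 : ℝ) < 1 / (i.2 + 1) := fun i => by positivity
  have hP : ∀ i x, IsProbabilityMeasure (atomicMeasure fun b : 𝓖.Fiber x => θ i b.1) := by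
    intro i x
    refine isProbabilityMeasure_atomicMeasure (fun b => hη0 _ (hK i) _ (hε i) _) ?_
    have hs : Summable fun b : 𝓖.Fiber x => θ i b.1 :=
      summable_of_hasFiniteSupport (hηf _ (hK i) _ (hε i) x)
    exact (hη1 _ (hK i) _ (hε i) x) ▸ hs.hasSum
  refine ⟨TopologicalSpace.Compacts G × ℕ, inferInstance, inferInstance, inferInstance,
    fun i x => ⟨_, hP i x⟩, ?_, ?_, ?_⟩
  · intro i x
    have := h.discreteTopology_fiber x
    have := hP i x
    exact regular_atomicMeasure (α := 𝓖.Fiber x) fun b => θ i b.1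
  · intro i f
    have e : (fun x => ∫ γ : 𝓖.Fiber x, f γ.1 ∂(atomicMeasure fun b : 𝓖.Fiber x => θ i b.1)) =
        fiberSum 𝓖.r fun b => (θ i b : ℂ) * f b := by
      funext x
      have := h.discreteTopology_fiber x
      exact integral_atomicMeasure (α := 𝓖.Fiber x) (fun b => hη0 _ (hK i) _ (hε i) _) (hηf _ (hK i) _ (hε i) x) _
    change Continuous fun x => ∫ γ : 𝓖.Fiber x, f γ.1 ∂(atomicMeasure fun b : 𝓖.Fiber x => θ i b.1)
    rw [e]
    refine h.isLocalHomeomorph_r.continuous_fiberSum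
      ((Complex.continuous_ofReal.comp (hηc _ (hK i) _ (hε i))).mul f.continuous) fun z => ?_
    refine ⟨tsupport f, f.hasCompactSupport, Eventually.of_forall fun _ e _ he => ?_⟩
    exact subset_tsupport _ (right_ne_zero_of_mul he)
  · intro K hKc
    rw [Metric.tendstoUniformlyOn_iff]
    intro ε hεpos
    obtain ⟨n, hn⟩ := exists_nat_one_div_lt hεpos
    filter_upwards [eventually_ge_atTop ((⟨K, hKc⟩ : TopologicalSpace.Compacts G), n)] with i hi γ hγ
    have hγi : γ ∈ (i.1 : Set G) := hi.1 hγ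
    have hni : (1 : ℝ) / (i.2 + 1) ≤ 1 / (n + 1) := by
      have : (n : ℝ) ≤ i.2 := by exact_mod_cast hi.2
      gcongr
    have := h.discreteTopology_fiber (𝓖.r γ)
    have := h.discreteTopology_fiber (𝓖.s γ)
    have hp := hP i (𝓖.r γ)
    have hp' := hP i (𝓖.s γ)
    refine lt_of_eq_of_lt ((dist_zero_left _).trans
      (abs_of_nonneg (translationDefect_nonneg _ γ))) (lt_of_le_of_lt ?_ hn)
    refine le_trans ?_ hni
    have hsum := hηd _ (hK i) _ (hε i) γ hγi
    refine le_trans ?_ hsum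
    -- a finite subset of the fibre over `r γ` carrying both measures
    have hf1 := hηf _ (hK i) _ (hε i) (𝓖.r γ)
    have hf2 := (hηf _ (hK i) _ (hε i) (𝓖.s γ)).preimage (f := 𝓖.ldivEquiv γ)
      (𝓖.ldivEquiv γ).injective.injOn
    let F : Finset (𝓖.Fiber (𝓖.r γ)) := (hf1.union hf2).toFinset
    have hF : ∀ b : 𝓖.Fiber (𝓖.r γ), b ∉ F → θ i b.1 = 0 ∧ θ i (𝓖.ldiv γ b.1) = 0 := by
      intro b hb
      have hb' : ¬ (θ i b.1 ≠ 0 ∨ θ i (𝓖.ldiv γ b.1) ≠ 0) :=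
        fun hc => hb (((hf1.union hf2).mem_toFinset).2 hc)
      push Not at hb'
      exact hb'
    have hbound := totalVariation_sub_le_sum
      ((atomicMeasure fun b : 𝓖.Fiber (𝓖.s γ) => θ i b.1).map (𝓖.translate γ))
      (atomicMeasure fun b : 𝓖.Fiber (𝓖.r γ) => θ i b.1) F ?_
      (atomicMeasure_compl_eq_zero fun b hb => (hF b hb).1)
    · refine hbound.trans (le_of_eq ?_)
      change _ = ∑' b : 𝓖.Fiber (𝓖.r γ), |θ i (𝓖.ldiv γ b.1) - θ i b.1|
      rw [tsum_eq_sum (s := F) fun b hb => by rw [(hF b hb).1, (hF b hb).2, sub_zero, abs_zero]]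
      refine Finset.sum_congr rfl fun b _ => ?_
      have hat : ∀ x (b : 𝓖.Fiber x), DiscreteTopology (𝓖.Fiber x) →
          (atomicMeasure fun b : 𝓖.Fiber x => θ i b.1).real {b} = θ i b.1 := fun x b _ =>
        atomicMeasure_real_singleton (hη0 _ (hK i) _ (hε i) _)
      exact congrArg abs (congrArg₂ _ ((h.map_translate_singleton γ _ b).trans
        (hat _ ⟨𝓖.ldiv γ b.1, r_ldiv b.2.symm⟩ inferInstance)) (hat _ b inferInstance))
    · rw [Measure.map_apply (h.measurable_translate γ) F.measurableSet.compl]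
      let F' : Finset (𝓖.Fiber (𝓖.s γ)) := F.image fun b => ⟨𝓖.ldiv γ b.1, r_ldiv b.2.symm⟩
      have hcl : (F' : Set (𝓖.Fiber (𝓖.s γ)))ᶜ = 𝓖.translate γ ⁻¹' (F : Set _)ᶜ := by
        ext c
        refine not_congr ?_
        rw [Finset.mem_coe]
        refine Finset.mem_image.trans ?_
        constructor
        · rintro ⟨b, hb, rfl⟩
          have : 𝓖.translate γ ⟨𝓖.ldiv γ b.1, r_ldiv b.2.symm⟩ = b :=
            Subtype.ext (mul_ldiv b.2.symm)
          change 𝓖.translate γ _ ∈ F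
          rwa [this]
        · intro hc
          exact ⟨_, hc, Subtype.ext (ldiv_mul c.2.symm)⟩
      rw [← hcl]
      refine atomicMeasure_compl_eq_zero fun c hc => ?_
      have hc' : 𝓖.translate γ c ∉ F := fun hm =>
        hc (Finset.mem_image.2 ⟨_, hm, Subtype.ext (ldiv_mul c.2.symm)⟩)
      have := (hF _ hc').2
      rwa [show 𝓖.ldiv γ (𝓖.translate γ c).1 = c.1 from ldiv_mul c.2.symm] at this

/-- In an amenable étale groupoid, the densities with respect to the counting measures of the fibres
give almost invariant continuous functions whose sums over the fibres are equal to `1`.  As the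
fibres may be uncountable, the fact that a measure is the sum of its atoms depends on its
regularity. -/
theorem IsEtale.exists_density {X : Type*} {G : Type*} {𝓖 : GroupoidStr X G}
    [TopologicalSpace X] [TopologicalSpace G] (h : 𝓖.IsEtale) (ha : 𝓖.IsAmenable)
    {K : Set G} (hK : IsCompact K) {ε : ℝ} (hε : 0 < ε) :
    ∃ μ : G → ℝ, Continuous μ ∧ (∀ a, 0 ≤ μ a) ∧
      (∀ x, ∀ F : Finset {b // 𝓖.r b = x}, ∑ b ∈ F, μ b ≤ 1) ∧
      (∀ x, ∀ δ > 0, ∃ F : Finset {b // 𝓖.r b = x}, 1 - δ < ∑ b ∈ F, μ b) ∧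
      ∀ γ ∈ K, ∀ F : Finset {b // 𝓖.r b = 𝓖.r γ}, ∑ b ∈ F, |μ (𝓖.ldiv γ b) - μ b| ≤ ε := by
  have hT2 := h.t2Space
  have hLC := h.locallyCompactSpace
  obtain ⟨I, _, _, _, m, hreg, hcont, hunif⟩ := ha
  obtain ⟨i, hi⟩ := ((Metric.tendstoUniformlyOn_iff.1 (hunif K hK)) ε hε).exists
  have hdisc := h.discreteTopology_fiber
  let μ : G → ℝ := fun b => (m i (𝓖.r b) : Measure (𝓖.Fiber (𝓖.r b))).real {⟨b, rfl⟩}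
  have hμ : ∀ x (b : 𝓖.Fiber x), μ b.1 = (m i x : Measure (𝓖.Fiber x)).real {b} := by
    rintro _ ⟨b, rfl⟩
    rfl
  have hsum : ∀ x (F : Finset (𝓖.Fiber x)),
      ∑ b ∈ F, μ b.1 = (m i x : Measure (𝓖.Fiber x)).real F := by
    intro x F
    rw [← sum_measureReal_singleton]
    exact Finset.sum_congr rfl fun b _ => hμ x b
  refine ⟨μ, ?_, fun _ => measureReal_nonneg, ?_, ?_, ?_⟩
  · rw [continuous_iff_continuousAt]
    intro b₀
    obtain ⟨U, hU, hb₀, hinj⟩ := h.isLocalHomeomorph_r.isLocallyInjective b₀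
    obtain ⟨f, hf1, hf0, hfc, -⟩ := exists_continuous_one_zero_of_isCompact
      (isCompact_singleton (x := b₀)) hU.isClosed_compl
      (disjoint_compl_right_iff_subset.2 (singleton_subset_iff.2 hb₀))
    let g : C_c(G, ℂ) := ⟨⟨fun b => (f b : ℂ), Complex.continuous_ofReal.comp f.continuous⟩,
      hfc.comp_left (g := fun t : ℝ => (t : ℂ)) Complex.ofReal_zero⟩
    have hval : ∀ b ∈ U, ∫ c : 𝓖.Fiber (𝓖.r b), g c.1 ∂(m i (𝓖.r b) : Measure _) =
        (μ b : ℂ) * f b := by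
      intro b hb
      refine integral_eq_of_forall_ne_eq_zero (α := 𝓖.Fiber (𝓖.r b)) _ (a := ⟨b, rfl⟩)
        (f := fun c => g c.1) fun c hc => ?_
      have hcU : c.1 ∈ Uᶜ := fun hcU => hc (Subtype.ext (hinj hcU hb c.2))
      change ((f c.1 : ℝ) : ℂ) = 0
      rw [hf0 hcU, Pi.zero_apply, Complex.ofReal_zero]
    have hfb₀ : f b₀ = 1 := hf1 rfl
    have hcg := (hcont i g).comp h.continuous_r
    have hne : ∀ᶠ b in 𝓝 b₀, f b ≠ 0 :=
      f.continuous.continuousAt.eventually_ne (by rw [hfb₀]; exact one_ne_zero)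
    have hc2 : ContinuousAt (fun b => (∫ c : 𝓖.Fiber (𝓖.r b), g c.1 ∂(m i (𝓖.r b) : Measure _)).re
        / f b) b₀ :=
      (Complex.continuous_re.comp hcg).continuousAt.div f.continuous.continuousAt
        (by rw [hfb₀]; exact one_ne_zero)
    refine hc2.congr ?_
    filter_upwards [hU.mem_nhds hb₀, hne] with b hb hb0
    rw [hval b hb, ← Complex.ofReal_mul, Complex.ofReal_re, mul_div_cancel_right₀ _ hb0]
  · intro x F
    exact (hsum x F).trans_le measureReal_le_one
  · intro x δ hδ
    have hlt : ENNReal.ofReal (1 - δ) < (m i x : Measure (𝓖.Fiber x)) univ := by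
      rw [measure_univ]
      exact ENNReal.ofReal_lt_one.2 (by linarith)
    obtain ⟨L, -, hL, hLm⟩ := (hreg i x).innerRegular isOpen_univ _ hlt
    have hLf : L.Finite := hL.finite_of_discrete
    refine ⟨hLf.toFinset, ?_⟩
    refine lt_of_lt_of_eq ?_ (hsum x hLf.toFinset).symm
    rw [Finite.coe_toFinset, measureReal_def]
    refine lt_imp_lt_of_le_imp_le ENNReal.ofReal_le_ofReal ?_
    rwa [ENNReal.ofReal_toReal (measure_ne_top _ _)]
  · intro γ hγ F
    have h1 := hi γ hγ
    rw [Real.dist_eq, zero_sub, abs_neg] at h1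
    refine le_trans ?_ ((le_abs_self _).trans h1.le)
    have h2 := SignedMeasure.sum_abs_singleton_le
      (((m i (𝓖.s γ) : Measure (𝓖.Fiber (𝓖.s γ))).map (𝓖.translate γ)).toSignedMeasure -
        (m i (𝓖.r γ) : Measure (𝓖.Fiber (𝓖.r γ))).toSignedMeasure) F
    refine le_trans (le_of_eq ?_) h2
    refine Finset.sum_congr rfl fun b _ => ?_
    have h3 : ∀ b : 𝓖.Fiber (𝓖.r γ), μ (𝓖.ldiv γ b.1) - μ b.1 =
        (((m i (𝓖.s γ) : Measure (𝓖.Fiber (𝓖.s γ))).map (𝓖.translate γ)).toSignedMeasure -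
          (m i (𝓖.r γ) : Measure (𝓖.Fiber (𝓖.r γ))).toSignedMeasure) {b} := by
      intro b
      rw [Measure.toSignedMeasure_sub_apply (measurableSet_singleton b),
        h.map_translate_singleton, ← hμ _ b, ← hμ (𝓖.s γ) ⟨𝓖.ldiv γ b.1, r_ldiv b.2.symm⟩]
    exact congrArg abs (h3 b)

end GroupoidStr

/-! ### Truncation of densities -/

namespace GroupoidStr

/-- In an amenable étale groupoid, almost invariant densities can be truncated to compactly
supported ones, whose sums over the fibres that matter for a given compact set remain close to
`1`. -/
theorem IsEtale.exists_density_hasCompactSupport {X : Type*} {G : Type*} {𝓖 : GroupoidStr X G}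
    [TopologicalSpace X] [TopologicalSpace G] (h : 𝓖.IsEtale) (ha : 𝓖.IsAmenable)
    {K : Set G} (hK : IsCompact K) {ε : ℝ} (hε : 0 < ε) :
    ∃ m : G → ℝ, Continuous m ∧ HasCompactSupport m ∧ (∀ a, 0 ≤ m a) ∧
      (∀ x, fiberSum 𝓖.r m x ≤ 1) ∧ (∀ x ∈ 𝓖.r '' K ∪ 𝓖.s '' K, 1 - ε ≤ fiberSum 𝓖.r m x) ∧
      ∀ γ ∈ K, fiberSum 𝓖.r (fun b => |m (𝓖.ldiv γ b) - m b|) (𝓖.r γ) ≤ ε := by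
  classical
  have hT2 := h.t2Space
  have hX := h.t2Space_units
  have hLC := h.locallyCompactSpace
  have hε3 : 0 < ε / 3 := by positivity
  obtain ⟨μ, hμc, hμ0, hμ1, hμs, hμd⟩ := h.exists_density ha hK hε3
  set K₀ := 𝓖.r '' K ∪ 𝓖.s '' K
  have hK₀ : IsCompact K₀ := (hK.image h.continuous_r).union (hK.image h.continuous_s)
  -- a compact set carrying most of the mass of each fibre over `K₀`
  obtain ⟨L, hL, hLm⟩ : ∃ L : Set G, IsCompact L ∧ ∀ x ∈ K₀, ∃ F : Finset {b // 𝓖.r b = x},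
      (∀ b ∈ F, b.1 ∈ L) ∧ 1 - ε / 3 < ∑ b ∈ F, μ b := by
    refine hK₀.induction_on (p := fun t => ∃ L : Set G, IsCompact L ∧ ∀ x ∈ t,
      ∃ F : Finset {b // 𝓖.r b = x}, (∀ b ∈ F, b.1 ∈ L) ∧ 1 - ε / 3 < ∑ b ∈ F, μ b) ?_ ?_ ?_ ?_
    · exact ⟨∅, isCompact_empty, fun x hx => hx.elim⟩
    · rintro s t hst ⟨L, hL, H⟩
      exact ⟨L, hL, fun x hx => H x (hst hx)⟩
    · rintro s t ⟨L, hL, H⟩ ⟨L', hL', H'⟩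
      refine ⟨L ∪ L', hL.union hL', fun x hx => ?_⟩
      rcases hx with hx | hx
      · obtain ⟨F, hF, hF'⟩ := H x hx
        exact ⟨F, fun b hb => Or.inl (hF b hb), hF'⟩
      · obtain ⟨F, hF, hF'⟩ := H' x hx
        exact ⟨F, fun b hb => Or.inr (hF b hb), hF'⟩
    · intro x _
      obtain ⟨F, hF⟩ := hμs x (ε / 3) hε3
      have hFc : IsCompact (Subtype.val '' (F : Set {b // 𝓖.r b = x})) :=
        (F.finite_toSet.image _).isCompact
      obtain ⟨f, hf1, -, hfc, hf01⟩ :=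
        exists_continuous_one_zero_of_isCompact hFc isClosed_empty (disjoint_empty _)
      have hcont : Continuous (fiberSum 𝓖.r fun b => μ b * f b) := by
        refine h.isLocalHomeomorph_r.continuous_fiberSum (hμc.mul f.continuous) fun z =>
          ⟨tsupport f, hfc, Eventually.of_forall fun _ e _ he => ?_⟩
        exact subset_tsupport _ (right_ne_zero_of_mul he)
      have hfin : ∀ y, (Function.support fun b : {b // 𝓖.r b = y} => μ b * f b).Finite :=
        fun y => h.isLocalHomeomorph_r.finite_support_fiber (f := fun b => μ b * f b) hfc y
          fun e _ he => subset_tsupport _ (right_ne_zero_of_mul he)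
      have hx : 1 - ε / 3 < fiberSum 𝓖.r (fun b => μ b * f b) x := by
        refine hF.trans_le ?_
        have hs : Summable fun b : {b // 𝓖.r b = x} => μ b * f b :=
          summable_of_hasFiniteSupport (hfin x)
        refine le_trans (le_of_eq ?_)
          (hs.sum_le_tsum F fun b _ => mul_nonneg (hμ0 _) (hf01 _).1)
        refine Finset.sum_congr rfl fun b hb => ?_
        beta_reduce
        rw [hf1 (mem_image_of_mem _ hb), Pi.one_apply, mul_one]
      refine ⟨_, mem_nhdsWithin_of_mem_nhds (hcont.continuousAt.eventually (lt_mem_nhds hx)),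
        tsupport f, hfc, fun y hy => ⟨(hfin y).toFinset, fun b hb => ?_, ?_⟩⟩
      · exact subset_tsupport _ (right_ne_zero_of_mul ((hfin y).mem_toFinset.1 hb))
      · refine lt_of_lt_of_le hy ?_
        rw [fiberSum, tsum_eq_sum (s := (hfin y).toFinset) fun b hb => by
          simpa only [Finite.mem_toFinset, Function.mem_support, not_not] using hb]
        exact Finset.sum_le_sum fun b _ => mul_le_of_le_one_right (hμ0 _) (hf01 _).2
  obtain ⟨f, hf1, -, hfc, hf01⟩ :=
    exists_continuous_one_zero_of_isCompact hL isClosed_empty (disjoint_empty _)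
  have hm0 : ∀ b, 0 ≤ μ b * f b := fun b => mul_nonneg (hμ0 b) (hf01 b).1
  have hmμ : ∀ b, μ b * f b ≤ μ b := fun b => mul_le_of_le_one_right (hμ0 b) (hf01 b).2
  have hfin : ∀ y, (Function.support fun b : {b // 𝓖.r b = y} => μ b * f b).Finite :=
    fun y => h.isLocalHomeomorph_r.finite_support_fiber (f := fun b => μ b * f b) hfc y
      fun e _ he => subset_tsupport _ (right_ne_zero_of_mul he)
  have hmF : ∀ x (F : Finset {b // 𝓖.r b = x}), (∀ b ∈ F, b.1 ∈ L) →
      ∑ b ∈ F, μ b * f b = ∑ b ∈ F, μ b := fun x F hF =>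
    Finset.sum_congr rfl fun b hb => by rw [hf1 (hF b hb), Pi.one_apply, mul_one]
  -- the truncation removes little mass
  have hrem : ∀ x ∈ K₀, ∀ F : Finset {b // 𝓖.r b = x}, ∑ b ∈ F, (μ b - μ b * f b) ≤ ε / 3 := by
    intro x hx F
    obtain ⟨F', hF', hF'm⟩ := hLm x hx
    have h1 : ∑ b ∈ F, (μ b - μ b * f b) ≤ ∑ b ∈ F ∪ F', (μ b - μ b * f b) :=
      Finset.sum_le_sum_of_subset_of_nonneg Finset.subset_union_left
        fun b _ _ => sub_nonneg.2 (hmμ b)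
    have h2 : ∑ b ∈ F', μ b * f b ≤ ∑ b ∈ F ∪ F', μ b * f b :=
      Finset.sum_le_sum_of_subset_of_nonneg Finset.subset_union_right fun b _ _ => hm0 b
    rw [hmF x F' hF'] at h2
    rw [Finset.sum_sub_distrib] at h1 ⊢
    rw [Finset.sum_sub_distrib] at h1
    have h3 := hμ1 x (F ∪ F')
    linarith
  refine ⟨fun b => μ b * f b, hμc.mul f.continuous, hfc.mul_left, hm0, ?_, ?_, ?_⟩
  · intro x
    exact Real.tsum_le_of_sum_le (fun b => hm0 b)
      fun F => (Finset.sum_le_sum fun b _ => hmμ b.1).trans (hμ1 x F)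
  · intro x hx
    obtain ⟨F, hF, hFm⟩ := hLm x hx
    have hs : Summable fun b : {b // 𝓖.r b = x} => μ b * f b :=
      summable_of_hasFiniteSupport (hfin x)
    have := hs.sum_le_tsum F fun b _ => hm0 b
    rw [hmF x F hF] at this
    change _ ≤ ∑' b : {b // 𝓖.r b = x}, μ b * f b
    linarith
  · intro γ hγ
    refine Real.tsum_le_of_sum_le (fun b => abs_nonneg _) fun F => ?_
    have h1 := hμd γ hγ F
    have h2 := hrem _ (Or.inl (mem_image_of_mem _ hγ)) F
    have h3 := hrem _ (Or.inr (mem_image_of_mem _ hγ)) (F.map (𝓖.ldivEquiv γ).toEmbedding)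
    rw [Finset.sum_map] at h3
    have h4 : ∀ b ∈ F, |μ (𝓖.ldiv γ b) * f (𝓖.ldiv γ b) - μ b * f b| ≤
        |μ (𝓖.ldiv γ b) - μ b| + (μ b - μ b * f b) +
          (μ (𝓖.ldiv γ b) - μ (𝓖.ldiv γ b) * f (𝓖.ldiv γ b)) := by
      intro b _
      have e1 := hmμ b
      have e2 := hmμ (𝓖.ldiv γ b)
      have e3 := neg_le_abs (μ (𝓖.ldiv γ b) - μ b)
      have e4 := le_abs_self (μ (𝓖.ldiv γ b) - μ b)
      exact abs_le.2 ⟨by linarith, by linarith⟩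
    refine (Finset.sum_le_sum h4).trans ?_
    rw [Finset.sum_add_distrib, Finset.sum_add_distrib]
    change ∑ b ∈ F, (μ (𝓖.ldiv γ b) - μ (𝓖.ldiv γ b) * f (𝓖.ldiv γ b)) ≤ _ at h3
    linarith

/-! ### Pulling back densities along a locally proper homomorphism -/

section Pullback

variable {X G W H : Type*} (𝓖 : GroupoidStr X G) (𝓗 : GroupoidStr W H) (ρ : G → H)

/-- The kernel `k(γ, b) = c₁(s(γ)) c₂(ρ(γ)⁻¹ b)`, for `b` in the fibre over `r(ρ(γ))`. It comes
from the function `(x, b) ↦ c₁(x) c₂(b)` on the `𝓖`-space of the pairs with `ρ(x) = r(b)`. -/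
noncomputable def cutKernel (c₁ : X → ℝ) (c₂ : H → ℝ) (γ : G) (b : H) : ℝ :=
  c₁ (𝓖.s γ) * c₂ (𝓗.ldiv (ρ γ) b)

/-- The total mass `N(x, b)` of the kernel `cutKernel` over the fibre of `x`. -/
noncomputable def cutMass (c₁ : X → ℝ) (c₂ : H → ℝ) (x : X) (b : H) : ℝ :=
  fiberSum 𝓖.r (fun γ => cutKernel 𝓖 𝓗 ρ c₁ c₂ γ b) x

/-- The function `γ ↦ ∑_b v(b) k(γ, b) / max(1, N(r(γ), b))` on `𝓖`, where `b` runs through the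
fibre over `r(ρ(γ))`. -/
noncomputable def pullDensity (c₁ : X → ℝ) (c₂ v : H → ℝ) (γ : G) : ℝ :=
  fiberSum 𝓗.r (fun b => v b * (cutKernel 𝓖 𝓗 ρ c₁ c₂ γ b / max 1 (cutMass 𝓖 𝓗 ρ c₁ c₂ (𝓖.r γ) b)))
    (IsHom.unitMap 𝓖 𝓗 ρ (𝓖.r γ))

/-- A continuous homomorphism of étale groupoids which is proper in the sense that `γ` is confined
to a compact set as soon as `r γ`, `s γ` and `ρ γ` are. -/
structure IsEtaleProperHom [TopologicalSpace X] [TopologicalSpace G] [TopologicalSpace W]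
    [TopologicalSpace H] : Prop where
  dom : 𝓖.IsEtale
  cod : 𝓗.IsEtale
  cont : Continuous ρ
  hom : 𝓖.IsHom 𝓗 ρ
  proper : ∀ C C' : Set X, IsCompact C → IsCompact C' → ∀ L : Set H, IsCompact L →
    ∃ M : Set G, IsCompact M ∧ ∀ γ, 𝓖.r γ ∈ C → 𝓖.s γ ∈ C' → ρ γ ∈ L → γ ∈ M

variable {𝓖 𝓗 ρ} {c₁ : X → ℝ} {c₂ : H → ℝ}

theorem cutKernel_nonneg (h₁ : ∀ x, 0 ≤ c₁ x) (h₂ : ∀ b, 0 ≤ c₂ b) (γ : G) (b : H) :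
    0 ≤ cutKernel 𝓖 𝓗 ρ c₁ c₂ γ b :=
  mul_nonneg (h₁ _) (h₂ _)

theorem IsHom.cutKernel_ldiv (hρ : 𝓖.IsHom 𝓗 ρ) {γ γ₁ : G} {b : H} (h : 𝓖.r γ = 𝓖.r γ₁)
    (hb : 𝓗.r (ρ γ) = 𝓗.r b) :
    cutKernel 𝓖 𝓗 ρ c₁ c₂ (𝓖.ldiv γ γ₁) (𝓗.ldiv (ρ γ) b) = cutKernel 𝓖 𝓗 ρ c₁ c₂ γ₁ b := by
  rw [cutKernel, cutKernel, s_ldiv, hρ.map_ldiv h, ldiv_ldiv (by rw [hρ.r_map, hρ.r_map, h]) hb]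

theorem IsHom.cutMass_ldiv (hρ : 𝓖.IsHom 𝓗 ρ) {γ : G} {b : H} (hb : 𝓗.r (ρ γ) = 𝓗.r b) :
    cutMass 𝓖 𝓗 ρ c₁ c₂ (𝓖.s γ) (𝓗.ldiv (ρ γ) b) = cutMass 𝓖 𝓗 ρ c₁ c₂ (𝓖.r γ) b := by
  rw [cutMass, ← fiberSum_ldiv γ]
  exact tsum_congr fun γ₁ => hρ.cutKernel_ldiv γ₁.2.symm hb

/-- Translating `pullDensity` by `γ` amounts to translating `v` by `ρ γ`. -/
theorem IsHom.pullDensity_ldiv (hρ : 𝓖.IsHom 𝓗 ρ) (v : H → ℝ) {γ γ₁ : G} (h : 𝓖.r γ = 𝓖.r γ₁) :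
    pullDensity 𝓖 𝓗 ρ c₁ c₂ v (𝓖.ldiv γ γ₁) =
      pullDensity 𝓖 𝓗 ρ c₁ c₂ (fun b => v (𝓗.ldiv (ρ γ) b)) γ₁ := by
  rw [pullDensity, pullDensity, r_ldiv h, ← hρ.s_map, ← fiberSum_ldiv (ρ γ), ← h, ← hρ.r_map]
  refine tsum_congr fun b => ?_
  beta_reduce
  rw [hρ.cutKernel_ldiv h b.2.symm, hρ.cutMass_ldiv b.2.symm]

theorem pullDensity_nonneg (h₁ : ∀ x, 0 ≤ c₁ x) (h₂ : ∀ b, 0 ≤ c₂ b) {v : H → ℝ}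
    (hv : ∀ b, 0 ≤ v b) (γ : G) : 0 ≤ pullDensity 𝓖 𝓗 ρ c₁ c₂ v γ :=
  tsum_nonneg fun _ => mul_nonneg (hv _) (div_nonneg (cutKernel_nonneg h₁ h₂ _ _)
    (zero_le_one.trans (le_max_left _ _)))

theorem abs_pullDensity_sub_le (h₁ : ∀ x, 0 ≤ c₁ x) (h₂ : ∀ b, 0 ≤ c₂ b) {v w : H → ℝ} {γ : G}
    (hv : (Function.support fun b : {b // 𝓗.r b = IsHom.unitMap 𝓖 𝓗 ρ (𝓖.r γ)} => v b).Finite)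
    (hw : (Function.support fun b : {b // 𝓗.r b = IsHom.unitMap 𝓖 𝓗 ρ (𝓖.r γ)} => w b).Finite) :
    |pullDensity 𝓖 𝓗 ρ c₁ c₂ v γ - pullDensity 𝓖 𝓗 ρ c₁ c₂ w γ| ≤
      pullDensity 𝓖 𝓗 ρ c₁ c₂ (fun b => |v b - w b|) γ := by
  let κ : {b // 𝓗.r b = IsHom.unitMap 𝓖 𝓗 ρ (𝓖.r γ)} → ℝ := fun b =>
    cutKernel 𝓖 𝓗 ρ c₁ c₂ γ b / max 1 (cutMass 𝓖 𝓗 ρ c₁ c₂ (𝓖.r γ) b)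
  have hκ : ∀ b, 0 ≤ κ b := fun b =>
    div_nonneg (cutKernel_nonneg h₁ h₂ _ _) (zero_le_one.trans (le_max_left _ _))
  have hvs : Summable fun b => v b.1 * κ b :=
    summable_of_hasFiniteSupport (hv.subset fun b hb => left_ne_zero_of_mul hb)
  have hws : Summable fun b => w b.1 * κ b :=
    summable_of_hasFiniteSupport (hw.subset fun b hb => left_ne_zero_of_mul hb)
  have e : ∀ b, ‖v b.1 * κ b - w b.1 * κ b‖ = |v b.1 - w b.1| * κ b := fun b => by
    rw [← sub_mul, norm_mul, Real.norm_of_nonneg (hκ b), Real.norm_eq_abs]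
  change |∑' b, v b.1 * κ b - ∑' b, w b.1 * κ b| ≤ ∑' b, |v b.1 - w b.1| * κ b
  rw [← hvs.tsum_sub hws, ← Real.norm_eq_abs]
  refine (norm_tsum_le_tsum_norm (hvs.sub hws).norm).trans (le_of_eq (tsum_congr e))

variable [TopologicalSpace X] [TopologicalSpace G] [TopologicalSpace W] [TopologicalSpace H]

namespace IsEtaleProperHom

/-- For `x` and `b` in compact sets, the kernel is supported in a compact set of arrows `γ`. -/
theorem exists_isCompact_cutKernel (hρ : IsEtaleProperHom 𝓖 𝓗 ρ) (h₁ : HasCompactSupport c₁)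
    (h₂ : HasCompactSupport c₂) {C : Set X} (hC : IsCompact C) {L : Set H} (hL : IsCompact L) :
    ∃ M : Set G, IsCompact M ∧ ∀ γ b, 𝓖.r γ ∈ C → b ∈ L → 𝓗.r b = IsHom.unitMap 𝓖 𝓗 ρ (𝓖.r γ) →
      cutKernel 𝓖 𝓗 ρ c₁ c₂ γ b ≠ 0 → γ ∈ M := by
  obtain ⟨M', hM', hM'm⟩ := hρ.cod.exists_isCompact_of_ldiv hL h₂
  obtain ⟨M, hM, hMm⟩ := hρ.proper C _ hC h₁ M' hM'
  refine ⟨M, hM, fun γ b hγ hb hγb hne => hMm γ hγ ?_ ?_⟩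
  · exact subset_tsupport _ (left_ne_zero_of_mul hne)
  · exact hM'm _ b (by rw [hρ.hom.r_map, hγb]) hb (subset_tsupport _ (right_ne_zero_of_mul hne))

theorem finite_support_cutKernel (hρ : IsEtaleProperHom 𝓖 𝓗 ρ) (h₁ : HasCompactSupport c₁)
    (h₂ : HasCompactSupport c₂) {x : X} {b : H} (hb : 𝓗.r b = IsHom.unitMap 𝓖 𝓗 ρ x) :
    (Function.support fun γ : {γ // 𝓖.r γ = x} => cutKernel 𝓖 𝓗 ρ c₁ c₂ γ b).Finite := by
  have := hρ.dom.t2Space_units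
  obtain ⟨M, hM, hMm⟩ := hρ.exists_isCompact_cutKernel h₁ h₂ (isCompact_singleton (x := x))
    (isCompact_singleton (x := b))
  exact hρ.dom.isLocalHomeomorph_r.finite_support_fiber
    (f := fun γ => cutKernel 𝓖 𝓗 ρ c₁ c₂ γ b) hM x
    fun γ hγ hne => hMm γ b hγ rfl (by rw [hγ, hb]) hne

theorem one_le_cutMass (hρ : IsEtaleProperHom 𝓖 𝓗 ρ) (h₁ : HasCompactSupport c₁)
    (h₂ : HasCompactSupport c₂) (h₁0 : ∀ x, 0 ≤ c₁ x) (h₂0 : ∀ b, 0 ≤ c₂ b) {x : X} {b : H}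
    (hx : c₁ x = 1) (hcb : c₂ b = 1) (hb : 𝓗.r b = IsHom.unitMap 𝓖 𝓗 ρ x) :
    1 ≤ cutMass 𝓖 𝓗 ρ c₁ c₂ x b := by
  have hs : Summable fun γ : {γ // 𝓖.r γ = x} => cutKernel 𝓖 𝓗 ρ c₁ c₂ γ b :=
    summable_of_hasFiniteSupport (hρ.finite_support_cutKernel h₁ h₂ hb)
  refine le_trans (le_of_eq ?_)
    (hs.le_tsum ⟨𝓖.unit x, 𝓖.r_unit x⟩ fun γ _ => cutKernel_nonneg h₁0 h₂0 _ _)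
  rw [cutKernel, 𝓖.s_unit, hx, hρ.hom.map_unit, ← hb, ldiv_unit, hcb, mul_one]

theorem continuousOn_cutKernel (hρ : IsEtaleProperHom 𝓖 𝓗 ρ) (h₁ : Continuous c₁)
    (h₂ : Continuous c₂) : ContinuousOn (fun p : G × H => cutKernel 𝓖 𝓗 ρ c₁ c₂ p.1 p.2)
      {p | 𝓗.r p.2 = IsHom.unitMap 𝓖 𝓗 ρ (𝓖.r p.1)} := by
  refine ContinuousOn.mul (h₁.comp (hρ.dom.continuous_s.comp continuous_fst)).continuousOn ?_
  refine h₂.comp_continuousOn (hρ.cod.continuousOn_ldiv.comp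
    (f := fun p : G × H => (ρ p.1, p.2)) ?_ fun p hp => ?_)
  · exact ((hρ.cont.comp continuous_fst).prodMk continuous_snd).continuousOn
  · exact (hρ.hom.r_map _).trans (Eq.symm hp)

theorem continuousOn_cutMass (hρ : IsEtaleProperHom 𝓖 𝓗 ρ) (h₁ : Continuous c₁)
    (h₂ : Continuous c₂) (h₁c : HasCompactSupport c₁) (h₂c : HasCompactSupport c₂) :
    ContinuousOn (fun p : X × H => cutMass 𝓖 𝓗 ρ c₁ c₂ p.1 p.2)
      {p | 𝓗.r p.2 = IsHom.unitMap 𝓖 𝓗 ρ p.1} := by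
  have := hρ.dom.t2Space
  have := hρ.dom.t2Space_units
  have := hρ.dom.locallyCompactSpace_units
  have := hρ.cod.locallyCompactSpace
  refine hρ.dom.isLocalHomeomorph_r.continuousOn_fiberSum
    (f := fun γ (p : X × H) => cutKernel 𝓖 𝓗 ρ c₁ c₂ γ p.2) continuousOn_fst ?_ ?_
  · refine (hρ.continuousOn_cutKernel h₁ h₂).comp (f := fun p : G × X × H => (p.1, p.2.2))
      (by fun_prop) ?_
    rintro ⟨γ, x, b⟩ ⟨hp, hγ⟩
    change 𝓗.r b = IsHom.unitMap 𝓖 𝓗 ρ (𝓖.r γ)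
    rw [show 𝓖.r γ = x from hγ]
    exact hp
  · rintro ⟨x, b⟩ -
    obtain ⟨C, hC, hxC⟩ := exists_compact_mem_nhds x
    obtain ⟨L, hL, hbL⟩ := exists_compact_mem_nhds b
    obtain ⟨M, hM, hMm⟩ := hρ.exists_isCompact_cutKernel h₁c h₂c hC hL
    refine ⟨M, hM, ?_⟩
    filter_upwards [mem_nhdsWithin_of_mem_nhds (prod_mem_nhds hxC hbL), self_mem_nhdsWithin]
      with p hp hpZ γ hγ hne
    exact hMm γ p.2 (by rw [hγ]; exact hp.1) hp.2 (by rw [hγ]; exact hpZ) hne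

theorem continuous_pullDensity (hρ : IsEtaleProperHom 𝓖 𝓗 ρ) (h₁ : Continuous c₁)
    (h₂ : Continuous c₂) (h₁c : HasCompactSupport c₁) (h₂c : HasCompactSupport c₂)
    {v : H → ℝ} (hv : Continuous v) (hvc : HasCompactSupport v) :
    Continuous (pullDensity 𝓖 𝓗 ρ c₁ c₂ v) := by
  have := hρ.cod.t2Space
  have := hρ.cod.t2Space_units
  rw [← continuousOn_univ]
  refine hρ.cod.isLocalHomeomorph_r.continuousOn_fiberSum
    (g := fun γ => IsHom.unitMap 𝓖 𝓗 ρ (𝓖.r γ))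
    (f := fun b γ => v b * (cutKernel 𝓖 𝓗 ρ c₁ c₂ γ b / max 1 (cutMass 𝓖 𝓗 ρ c₁ c₂ (𝓖.r γ) b)))
    ((IsHom.continuous_unitMap hρ.dom.toIsLocallyCompactGroupoid
      hρ.cod.toIsLocallyCompactGroupoid hρ.cont).comp hρ.dom.continuous_r).continuousOn ?_ ?_
  · refine (hv.comp continuous_fst).continuousOn.mul (ContinuousOn.div ?_ ?_ ?_)
    · exact (hρ.continuousOn_cutKernel h₁ h₂).comp (f := fun p : H × G => (p.2, p.1))
        (by fun_prop) fun p hp => hp.2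
    · refine continuousOn_const.sup ((hρ.continuousOn_cutMass h₁ h₂ h₁c h₂c).comp
        (f := fun p : H × G => (𝓖.r p.2, p.1)) ?_ fun p hp => hp.2)
      exact ((hρ.dom.continuous_r.comp continuous_snd).prodMk continuous_fst).continuousOn
    · exact fun p _ => (lt_max_of_lt_left one_pos).ne'
  · exact fun γ _ => ⟨tsupport v, hvc, Eventually.of_forall fun _ b _ hne =>
      subset_tsupport _ (left_ne_zero_of_mul hne)⟩

/-- Over a compact set of units, `pullDensity` is supported in a compact set. -/
theorem exists_isCompact_pullDensity (hρ : IsEtaleProperHom 𝓖 𝓗 ρ) (h₁ : HasCompactSupport c₁)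
    (h₂ : HasCompactSupport c₂) {v : H → ℝ} (hv : HasCompactSupport v) {C : Set X}
    (hC : IsCompact C) :
    ∃ M : Set G, IsCompact M ∧ ∀ γ, 𝓖.r γ ∈ C → pullDensity 𝓖 𝓗 ρ c₁ c₂ v γ ≠ 0 → γ ∈ M := by
  obtain ⟨M, hM, hMm⟩ := hρ.exists_isCompact_cutKernel h₁ h₂ hC hv
  refine ⟨M, hM, fun γ hγ hne => ?_⟩
  by_contra hγM
  refine hne ((tsum_congr fun b => ?_).trans tsum_zero)
  by_contra hb
  beta_reduce at hb
  refine hγM (hMm γ b hγ (subset_tsupport _ (left_ne_zero_of_mul hb)) b.2 fun h0 => ?_)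
  rw [h0, zero_div, mul_zero] at hb
  exact hb rfl

/-- The sum of `pullDensity` over a fibre, computed by exchanging the two summations. -/
theorem fiberSum_pullDensity (hρ : IsEtaleProperHom 𝓖 𝓗 ρ) (h₁ : HasCompactSupport c₁)
    (h₂ : HasCompactSupport c₂) {v : H → ℝ} {x : X}
    (hv : (Function.support fun b : {b // 𝓗.r b = IsHom.unitMap 𝓖 𝓗 ρ x} => v b).Finite) :
    fiberSum 𝓖.r (pullDensity 𝓖 𝓗 ρ c₁ c₂ v) x =
      fiberSum 𝓗.r (fun b => v b * (cutMass 𝓖 𝓗 ρ c₁ c₂ x b / max 1 (cutMass 𝓖 𝓗 ρ c₁ c₂ x b)))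
        (IsHom.unitMap 𝓖 𝓗 ρ x) := by
  have e : ∀ γ : {γ // 𝓖.r γ = x}, pullDensity 𝓖 𝓗 ρ c₁ c₂ v γ =
      ∑' b : {b // 𝓗.r b = IsHom.unitMap 𝓖 𝓗 ρ x},
        v b * (cutKernel 𝓖 𝓗 ρ c₁ c₂ γ b / max 1 (cutMass 𝓖 𝓗 ρ c₁ c₂ x b)) := by
    rintro ⟨γ, rfl⟩
    rfl
  refine (tsum_congr e).trans ((tsum_comm_of_finite hv ?_ ?_).trans (tsum_congr fun b => ?_))
  · exact fun γ b hne => left_ne_zero_of_mul hne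
  · intro b _
    refine (hρ.finite_support_cutKernel h₁ h₂ b.2).subset fun γ hγ h0 => hγ ?_
    simp only [h0, zero_div, mul_zero]
  · rw [tsum_mul_left, tsum_div_const]
    rfl

/-- Amenability passes from the target to the source of a proper homomorphism of étale
groupoids. -/
theorem isAmenable (hρ : IsEtaleProperHom 𝓖 𝓗 ρ) (ha : 𝓗.IsAmenable) : 𝓖.IsAmenable := by
  classical
  refine hρ.dom.isAmenable_of_density fun K hK ε hε => ?_
  have := hρ.dom.t2Space
  have := hρ.dom.t2Space_units
  have := hρ.dom.locallyCompactSpace_units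
  have := hρ.cod.t2Space
  have := hρ.cod.t2Space_units
  have := hρ.cod.locallyCompactSpace
  set π₀ := IsHom.unitMap 𝓖 𝓗 ρ
  obtain ⟨m, hmc, hms, hm0, hm1, hmK, hmd⟩ := hρ.cod.exists_density_hasCompactSupport ha
    (hK.image hρ.cont) (by positivity : 0 < ε / 3)
  have hK₀ : IsCompact (𝓖.r '' K ∪ 𝓖.s '' K) :=
    (hK.image hρ.dom.continuous_r).union (hK.image hρ.dom.continuous_s)
  obtain ⟨c₁, h₁K, -, h₁c, h₁01⟩ :=
    exists_continuous_one_zero_of_isCompact hK₀ isClosed_empty (disjoint_empty _)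
  obtain ⟨c₂, h₂m, -, h₂c, h₂01⟩ := exists_continuous_one_zero_of_isCompact
    (show IsCompact (tsupport m) from hms) isClosed_empty (disjoint_empty _)
  have h₁0 : ∀ x, 0 ≤ c₁ x := fun x => (h₁01 x).1
  have h₂0 : ∀ b, 0 ≤ c₂ b := fun b => (h₂01 b).1
  have hmfin : ∀ y, (Function.support fun b : {b // 𝓗.r b = y} => m b).Finite := fun y =>
    hρ.cod.isLocalHomeomorph_r.finite_support_fiber (f := m) hms y
      fun b _ hb => subset_tsupport _ hb
  set η := pullDensity 𝓖 𝓗 ρ c₁ c₂ m with hη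
  have hη0 : ∀ γ, 0 ≤ η γ := pullDensity_nonneg h₁0 h₂0 hm0
  have hηc : Continuous η :=
    hρ.continuous_pullDensity c₁.continuous c₂.continuous h₁c h₂c hmc hms
  have hηfin : ∀ x, (Function.support fun b : {b // 𝓖.r b = x} => η b).Finite := by
    intro x
    obtain ⟨M, hM, hMm⟩ := hρ.exists_isCompact_pullDensity h₁c h₂c hms
      (isCompact_singleton (x := x))
    exact hρ.dom.isLocalHomeomorph_r.finite_support_fiber (f := η) hM x fun γ hγ hne =>
      hMm γ hγ hne
  have hratio : ∀ t : ℝ, t / max 1 t ≤ 1 := fun t =>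
    div_le_one_of_le₀ (le_max_right _ _) (zero_le_one.trans (le_max_left _ _))
  have hcontract : ∀ x (v : H → ℝ), (∀ b, 0 ≤ v b) →
      (Function.support fun b : {b // 𝓗.r b = π₀ x} => v b).Finite →
      fiberSum 𝓖.r (pullDensity 𝓖 𝓗 ρ c₁ c₂ v) x ≤ fiberSum 𝓗.r v (π₀ x) := by
    intro x v hv0 hv
    rw [hρ.fiberSum_pullDensity h₁c h₂c hv]
    refine Summable.tsum_le_tsum (fun b => mul_le_of_le_one_right (hv0 _) (hratio _)) ?_
      (summable_of_hasFiniteSupport hv)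
    exact summable_of_hasFiniteSupport (hv.subset fun b hb => left_ne_zero_of_mul hb)
  set S := fiberSum 𝓖.r η with hS
  have hS1 : ∀ x, S x ≤ 1 := fun x => (hcontract x m hm0 (hmfin _)).trans (hm1 _)
  have hSc : Continuous S := by
    refine hρ.dom.isLocalHomeomorph_r.continuous_fiberSum hηc fun x => ?_
    obtain ⟨C, hC, hxC⟩ := exists_compact_mem_nhds x
    obtain ⟨M, hM, hMm⟩ := hρ.exists_isCompact_pullDensity h₁c h₂c hms hC
    refine ⟨M, hM, ?_⟩
    filter_upwards [hxC] with z hz γ hγ hne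
    exact hMm γ (by rw [hγ]; exact hz) hne
  have hSK : ∀ x ∈ 𝓖.r '' K ∪ 𝓖.s '' K, 1 - ε / 3 ≤ S x := by
    intro x hx
    have hx' : π₀ x ∈ 𝓗.r '' (ρ '' K) ∪ 𝓗.s '' (ρ '' K) := by
      rcases hx with ⟨γ, hγ, rfl⟩ | ⟨γ, hγ, rfl⟩
      · exact Or.inl ⟨ρ γ, mem_image_of_mem _ hγ, hρ.hom.r_map γ⟩
      · exact Or.inr ⟨ρ γ, mem_image_of_mem _ hγ, hρ.hom.s_map γ⟩
    refine (hmK _ hx').trans (le_of_eq ?_)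
    rw [hS, hη, hρ.fiberSum_pullDensity h₁c h₂c (hmfin _)]
    refine tsum_congr fun b => ?_
    beta_reduce
    by_cases hb : m b = 0
    · rw [hb, zero_mul]
    · have hN := hρ.one_le_cutMass h₁c h₂c h₁0 h₂0 (h₁K hx) (h₂m (subset_tsupport _ hb)) b.2
      rw [max_eq_right hN, div_self (zero_lt_one.trans_le hN).ne', mul_one]
  -- the missing mass is placed at the unit
  let u : G → ℝ := (range 𝓖.unit).indicator fun γ => 1 - S (𝓖.r γ)
  have hu0 : ∀ γ, 0 ≤ u γ := fun γ => indicator_nonneg (fun _ _ => sub_nonneg.2 (hS1 _)) γ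
  have huc : Continuous u :=
    (continuous_const.sub (hSc.comp hρ.dom.continuous_r)).indicator fun γ hγ => by
      rw [hρ.dom.isClopen_range_unit.frontier_eq] at hγ
      exact hγ.elim
  have hune : ∀ x (γ : {γ // 𝓖.r γ = x}), γ ≠ ⟨𝓖.unit x, 𝓖.r_unit x⟩ → u γ = 0 := by
    rintro x ⟨γ, hγ⟩ hne
    refine indicator_of_notMem ?_ _
    rintro ⟨y, rfl⟩
    refine hne (Subtype.ext ?_)
    rw [𝓖.r_unit] at hγ
    exact congrArg 𝓖.unit hγ
  have hufin : ∀ x, (Function.support fun γ : {γ // 𝓖.r γ = x} => u γ).Finite := fun x =>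
    (finite_singleton (⟨𝓖.unit x, 𝓖.r_unit x⟩ : {γ // 𝓖.r γ = x})).subset fun γ hγ =>
      not_imp_comm.1 (hune x γ) hγ
  have hus : ∀ x, fiberSum 𝓖.r u x = 1 - S x := by
    intro x
    rw [fiberSum, tsum_eq_single _ (hune x)]
    exact (indicator_of_mem (mem_range_self x) _).trans (by rw [𝓖.r_unit])
  have hηsum : ∀ x, Summable fun γ : {γ // 𝓖.r γ = x} => η γ := fun x =>
    summable_of_hasFiniteSupport (hηfin x)
  have husum : ∀ x, Summable fun γ : {γ // 𝓖.r γ = x} => u γ := fun x =>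
    summable_of_hasFiniteSupport (hufin x)
  refine ⟨fun γ => η γ + u γ, hηc.add huc, fun γ => add_nonneg (hη0 γ) (hu0 γ), fun x => ?_,
    fun x => ?_, fun γ hγ => ?_⟩
  · refine ((hηfin x).union (hufin x)).subset fun γ hγ => ?_
    by_contra hne
    simp only [mem_union, Function.mem_support, not_or, not_not] at hne
    exact hγ (by beta_reduce; rw [hne.1, hne.2, add_zero])
  · have := (hηsum x).tsum_add (husum x)
    refine this.trans ?_
    change S x + fiberSum 𝓖.r u x = 1
    rw [hus]
    ring
  · -- the translate of `m` by `ρ γ`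
    have hfinr : (Function.support fun b : {b // 𝓗.r b = 𝓗.r (ρ γ)} => m (𝓗.ldiv (ρ γ) b)).Finite :=
      (hmfin _).preimage (f := 𝓗.ldivEquiv (ρ γ)) (𝓗.ldivEquiv (ρ γ)).injective.injOn
    rw [hρ.hom.r_map] at hfinr
    let v : H → ℝ := fun b => |m (𝓗.ldiv (ρ γ) b) - m b|
    have hvfin : (Function.support fun b : {b // 𝓗.r b = π₀ (𝓖.r γ)} => v b).Finite := by
      refine (hfinr.union (hmfin _)).subset fun b hb => ?_
      by_contra hne
      simp only [mem_union, Function.mem_support, not_or, not_not] at hne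
      exact hb (by simp only [v, hne.1, hne.2, sub_zero, abs_zero])
    have hvs : fiberSum 𝓖.r (pullDensity 𝓖 𝓗 ρ c₁ c₂ v) (𝓖.r γ) ≤ ε / 3 := by
      refine (hcontract _ v (fun b => abs_nonneg _) hvfin).trans ?_
      have := hmd (ρ γ) (mem_image_of_mem _ hγ)
      rwa [hρ.hom.r_map] at this
    have hpoint : ∀ γ₁ : {γ₁ // 𝓖.r γ₁ = 𝓖.r γ},
        |(η (𝓖.ldiv γ γ₁) + u (𝓖.ldiv γ γ₁)) - (η γ₁ + u γ₁)| ≤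
          pullDensity 𝓖 𝓗 ρ c₁ c₂ v γ₁ + u (𝓖.ldiv γ γ₁) + u γ₁ := by
      rintro ⟨γ₁, hγ₁⟩
      have e1 : |η (𝓖.ldiv γ γ₁) - η γ₁| ≤ pullDensity 𝓖 𝓗 ρ c₁ c₂ v γ₁ := by
        rw [hη, hρ.hom.pullDensity_ldiv m hγ₁.symm]
        refine abs_pullDensity_sub_le h₁0 h₂0 ?_ (hmfin _)
        rw [hγ₁]
        exact hfinr
      have e2 := abs_le.1 e1
      have e3 := hu0 (𝓖.ldiv γ γ₁)
      have e4 := hu0 γ₁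
      exact abs_le.2 ⟨by linarith [e2.1], by linarith [e2.2]⟩
    have hPfin : (Function.support fun γ₁ : {γ₁ // 𝓖.r γ₁ = 𝓖.r γ} =>
        pullDensity 𝓖 𝓗 ρ c₁ c₂ v γ₁).Finite := by
      refine (hvfin.biUnion fun b _ => hρ.finite_support_cutKernel h₁c h₂c b.2).subset ?_
      rintro ⟨γ₁, hγ₁⟩ hne
      by_contra hcon
      refine hne ((tsum_congr fun b => ?_).trans tsum_zero)
      by_contra hb
      have hbv := left_ne_zero_of_mul hb
      have hbk := right_ne_zero_of_mul hb
      refine hcon (mem_biUnion (x := ⟨b.1, by rw [b.2, hγ₁]⟩) hbv fun h0 => hbk ?_)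
      rw [show cutKernel 𝓖 𝓗 ρ c₁ c₂ γ₁ b.1 = 0 from h0, zero_div]
    have hPs : Summable fun γ₁ : {γ₁ // 𝓖.r γ₁ = 𝓖.r γ} => pullDensity 𝓖 𝓗 ρ c₁ c₂ v γ₁ :=
      summable_of_hasFiniteSupport hPfin
    have hu's : Summable fun γ₁ : {γ₁ // 𝓖.r γ₁ = 𝓖.r γ} => u (𝓖.ldiv γ γ₁) :=
      (𝓖.ldivEquiv γ).summable_iff.2 (husum (𝓖.s γ))
    have hu'e : ∑' γ₁ : {γ₁ // 𝓖.r γ₁ = 𝓖.r γ}, u (𝓖.ldiv γ γ₁) = 1 - S (𝓖.s γ) :=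
      (fiberSum_ldiv γ u).trans (hus _)
    have hue : ∑' γ₁ : {γ₁ // 𝓖.r γ₁ = 𝓖.r γ}, u γ₁ = 1 - S (𝓖.r γ) := hus _
    have hbig := (hPs.add hu's).add (husum (𝓖.r γ))
    refine (Summable.tsum_le_tsum hpoint
      (Summable.of_nonneg_of_le (fun _ => abs_nonneg _) hpoint hbig) hbig).trans ?_
    rw [(hPs.add hu's).tsum_add (husum _), hPs.tsum_add hu's, hu'e, hue]
    have e1 := hSK (𝓖.r γ) (Or.inl (mem_image_of_mem _ hγ))
    have e2 := hSK (𝓖.s γ) (Or.inr (mem_image_of_mem _ hγ))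
    change ∑' γ₁ : {γ₁ // 𝓖.r γ₁ = 𝓖.r γ}, pullDensity 𝓖 𝓗 ρ c₁ c₂ v γ₁ ≤ ε / 3 at hvs
    linarith

end IsEtaleProperHom

end Pullback

end GroupoidStr

namespace GroupoidStr

/-! ### The semi-direct product of an étale groupoid is étale -/

namespace GSpace

section Etale

variable {X G Y : Type*} [TopologicalSpace X] [TopologicalSpace G] [TopologicalSpace Y]
  {𝓖 : GroupoidStr X G}

theorem isClosedEmbedding_val (𝓨 : GSpace 𝓖 Y) (h : 𝓖.IsEtale) :
    IsClosedEmbedding (Subtype.val : {z : Y × G // 𝓨.p z.1 = 𝓖.r z.2} → Y × G) := by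
  have := h.t2Space_units
  exact (isClosed_eq (𝓨.continuous_p.comp continuous_fst)
    (h.continuous_r.comp continuous_snd)).isClosedEmbedding_subtypeVal

theorem continuous_act_comp (𝓨 : GSpace 𝓖 Y) {T : Type*} [TopologicalSpace T] {a : T → G} {y : T → Y}
    (ha : Continuous a) (hy : Continuous y) (hay : ∀ t, 𝓖.s (a t) = 𝓨.p (y t)) :
    Continuous fun t => 𝓨.act (a t) (y t) (hay t) :=
  𝓨.continuous_act.comp ((ha.prodMk hy).subtype_mk hay)

theorem isOpenMap_semidirect_r (𝓨 : GSpace 𝓖 Y) (h : 𝓖.IsEtale) :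
    IsOpenMap 𝓨.semidirect.r := by
  refine isOpenMap_iff_nhds_le.2 fun z N hN => ?_
  rw [mem_map, nhds_subtype_eq_comap, mem_comap] at hN
  obtain ⟨V, hV, hVN⟩ := hN
  rw [nhds_prod_eq, mem_prod_iff] at hV
  obtain ⟨A, hA, B, hB, hAB⟩ := hV
  have hrB : 𝓖.r '' B ∈ 𝓝 (𝓨.p z.1.1) := by
    rw [z.2]
    exact h.isOpenMap_r.image_mem_nhds hB
  filter_upwards [hA, 𝓨.continuous_p.continuousAt hrB] with y hyA hyB
  obtain ⟨γ, hγB, hγ⟩ := hyB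
  exact hVN (show (⟨(y, γ), hγ.symm⟩ : {z : Y × G // 𝓨.p z.1 = 𝓖.r z.2}) ∈ Subtype.val ⁻¹' V
    from hAB ⟨hyA, hγB⟩)

theorem isLocalHomeomorph_semidirect_r (𝓨 : GSpace 𝓖 Y) (h : 𝓖.IsEtale) :
    IsLocalHomeomorph 𝓨.semidirect.r := by
  have hc : Continuous 𝓨.semidirect.r := continuous_fst.comp continuous_subtype_val
  refine isLocalHomeomorph_iff_isOpenEmbedding_restrict.2 fun z => ?_
  obtain ⟨V, hV, hzV, hinj⟩ := h.isLocalHomeomorph_r.isLocallyInjective z.1.2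
  have hU : IsOpen {z : {z : Y × G // 𝓨.p z.1 = 𝓖.r z.2} | z.1.2 ∈ V} :=
    hV.preimage (continuous_snd.comp continuous_subtype_val)
  refine ⟨_, hU.mem_nhds hzV, IsOpenEmbedding.of_continuous_injective_isOpenMap
    (hc.comp continuous_subtype_val) ?_ ((𝓨.isOpenMap_semidirect_r h).comp hU.isOpenMap_subtype_val)⟩
  rintro ⟨⟨⟨y, γ⟩, hz⟩, hzV⟩ ⟨⟨⟨y', γ'⟩, hz'⟩, hzV'⟩ (rfl : y = y')
  obtain rfl : γ = γ' := hinj hzV hzV' (hz.symm.trans hz')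
  rfl

theorem isEtale_semidirect (𝓨 : GSpace 𝓖 Y) (h : 𝓖.IsEtale) : 𝓨.semidirect.IsEtale where
  t2Space := by
    have := h.t2Space
    have := 𝓨.t2Space
    infer_instance
  locallyCompactSpace := by
    have := h.locallyCompactSpace
    have := 𝓨.locallyCompactSpace
    exact (𝓨.isClosedEmbedding_val h).locallyCompactSpace
  continuous_r := continuous_fst.comp continuous_subtype_val
  continuous_s := 𝓨.continuous_act_comp
    (h.continuous_inv.comp (continuous_snd.comp continuous_subtype_val))
    (continuous_fst.comp continuous_subtype_val) _
  continuous_unit := (continuous_id.prodMk (h.continuous_unit.comp 𝓨.continuous_p)).subtype_mk _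
  continuous_inv := ((𝓨.continuous_act_comp
    (h.continuous_inv.comp (continuous_snd.comp continuous_subtype_val))
    (continuous_fst.comp continuous_subtype_val) _).prodMk
      (h.continuous_inv.comp (continuous_snd.comp continuous_subtype_val))).subtype_mk _
  continuous_mul := by
    have c1 : Continuous fun z : {z : {z : Y × G // 𝓨.p z.1 = 𝓖.r z.2} ×
        {z : Y × G // 𝓨.p z.1 = 𝓖.r z.2} // 𝓨.semidirect.s z.1 = 𝓨.semidirect.r z.2} =>
        z.1.1.1.2 := by fun_prop
    have c2 : Continuous fun z : {z : {z : Y × G // 𝓨.p z.1 = 𝓖.r z.2} ×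
        {z : Y × G // 𝓨.p z.1 = 𝓖.r z.2} // 𝓨.semidirect.s z.1 = 𝓨.semidirect.r z.2} =>
        z.1.2.1.2 := by fun_prop
    refine Continuous.subtype_mk (Continuous.prodMk (by fun_prop) ?_) _
    exact h.continuous_mul.comp ((c1.prodMk c2).subtype_mk fun z => by
      rw [← z.1.2.2]
      exact ((congrArg 𝓨.p z.2.symm).trans ((𝓨.p_act _ _ _).trans (𝓖.r_inv _))).symm)
  isOpenMap_r := 𝓨.isOpenMap_semidirect_r h
  isLocalHomeomorph_r := 𝓨.isLocalHomeomorph_semidirect_r h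

end Etale

end GSpace

/-! ### A small invariant subspace of the pulled-back space -/

section Orbit

variable {X G W H Y : Type*} [TopologicalSpace W] [TopologicalSpace H] [TopologicalSpace Y]
  {𝓖 : GroupoidStr X G} {𝓗 : GroupoidStr W H} {ρ : G → H}

/-- The pairs of `X × Y` lying in the orbit of the section `x ↦ (x, σ(ρ(x)))` of the fibre product
of `X` and `Y` under the action `γ(x, y) = (r(γ), ρ(γ)y)`, parametrised by `𝓖`. -/
def orbitMap (𝓨 : GSpace 𝓗 Y) (hρ : 𝓖.IsHom 𝓗 ρ) (σ : W → Y) (hσ : ∀ w, 𝓨.p (σ w) = w) (γ : G) :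
    X × Y :=
  (𝓖.r γ, 𝓨.act (ρ γ) (σ (IsHom.unitMap 𝓖 𝓗 ρ (𝓖.s γ))) (by rw [hσ, hρ.s_map]))

/-- The closure of the range of a map defined on a type in `Type u` is `u`-small, as its points are
limits of ultrafilters. -/
theorem small_closure_range {A : Type u} {B : Type v} [TopologicalSpace B] [T2Space B] (f : A → B) :
    Small.{u} (closure (range f)) := by
  have h : ∀ z : closure (range f), ∃ U : Ultrafilter A, Tendsto f U (𝓝 z.1) := by
    rintro ⟨z, hz⟩
    have hne : (comap f (𝓝 z)).NeBot := comap_neBot fun N hN => by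
      obtain ⟨_, hN', ⟨a, rfl⟩⟩ := mem_closure_iff_nhds.1 hz N hN
      exact ⟨a, hN'⟩
    exact ⟨Ultrafilter.of _, tendsto_comap.mono_left (Ultrafilter.of_le _)⟩
  choose U hU using h
  refine small_of_injective (f := U) fun z z' hzz => Subtype.ext ?_
  exact tendsto_nhds_unique (hU z) (hzz ▸ hU z')

variable {𝓨 : GSpace 𝓗 Y} {hρ : 𝓖.IsHom 𝓗 ρ} {σ : W → Y} {hσ : ∀ w, 𝓨.p (σ w) = w}

theorem section_mem_range_orbitMap (x : X) :
    (x, σ (IsHom.unitMap 𝓖 𝓗 ρ x)) ∈ range (orbitMap 𝓨 hρ σ hσ) := by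
  refine ⟨𝓖.unit x, Prod.ext (𝓖.r_unit x) ?_⟩
  refine (𝓨.act_congr ?_ ?_ _ (𝓗.s_unit _)).trans (𝓨.unit_act _)
  · rw [hρ.map_unit, hσ]
  · rw [𝓖.s_unit]

variable [TopologicalSpace X] [TopologicalSpace G]

theorem unitMap_eq_of_mem_closure (h𝓖 : 𝓖.IsLocallyCompactGroupoid)
    (h𝓗 : 𝓗.IsLocallyCompactGroupoid) (hρc : Continuous ρ) {z : X × Y}
    (hz : z ∈ closure (range (orbitMap 𝓨 hρ σ hσ))) :
    IsHom.unitMap 𝓖 𝓗 ρ z.1 = 𝓨.p z.2 := by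
  have := h𝓗.t2Space_units
  have hcl : IsClosed {z : X × Y | IsHom.unitMap 𝓖 𝓗 ρ z.1 = 𝓨.p z.2} :=
    isClosed_eq ((IsHom.continuous_unitMap h𝓖 h𝓗 hρc).comp continuous_fst)
      (𝓨.continuous_p.comp continuous_snd)
  refine closure_minimal ?_ hcl hz
  rintro _ ⟨γ, rfl⟩
  exact (hρ.r_map γ).symm.trans (𝓨.p_act _ _ _).symm

/-- The closure of the orbit of the section is invariant; this uses that the source map is open. -/
theorem act_mem_closure (h𝓖 : 𝓖.IsLocallyCompactGroupoid) (hρc : Continuous ρ) {z : X × Y}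
    (hz : z ∈ closure (range (orbitMap 𝓨 hρ σ hσ))) {γ : G}
    (hγ : 𝓖.s γ = z.1) (h : 𝓗.s (ρ γ) = 𝓨.p z.2) :
    (𝓖.r γ, 𝓨.act (ρ γ) z.2 h) ∈ closure (range (orbitMap 𝓨 hρ σ hσ)) := by
  let T : {t : G × X × Y // 𝓗.s (ρ t.1) = 𝓨.p t.2.2} → X × Y := fun t =>
    (𝓖.r t.1.1, 𝓨.act (ρ t.1.1) t.1.2.2 t.2)
  have hT : Continuous T :=
    (h𝓖.continuous_r.comp (continuous_fst.comp continuous_subtype_val)).prodMk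
      (𝓨.continuous_act_comp (hρc.comp (continuous_fst.comp continuous_subtype_val))
        (continuous_snd.comp (continuous_snd.comp continuous_subtype_val)) fun t => t.2)
  refine mem_closure_iff_nhds.2 fun N hN => ?_
  have hN' : T ⁻¹' N ∈ 𝓝 ⟨(γ, z), h⟩ := hT.continuousAt hN
  rw [nhds_subtype_eq_comap, mem_comap] at hN'
  obtain ⟨V, hV, hVN⟩ := hN'
  rw [nhds_prod_eq, mem_prod_iff] at hV
  obtain ⟨A, hA, B, hB, hAB⟩ := hV
  have hsA : 𝓖.s '' A ∈ 𝓝 z.1 := hγ ▸ h𝓖.isOpenMap_s.image_mem_nhds hA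
  obtain ⟨_, ⟨hB', ⟨γ', hγ'A, hγ'⟩⟩, ⟨γ₁, rfl⟩⟩ := mem_closure_iff_nhds.1 hz _
    (inter_mem hB (continuous_fst.continuousAt hsA))
  have hcomp : 𝓖.s γ' = 𝓖.r γ₁ := hγ'
  obtain ⟨h1, h2⟩ := hρ γ' γ₁ hcomp
  have h3 : 𝓗.s (ρ γ') = 𝓨.p (orbitMap 𝓨 hρ σ hσ γ₁).2 := h1.trans (𝓨.p_act _ _ _).symm
  refine ⟨_, hVN (show (⟨(γ', orbitMap 𝓨 hρ σ hσ γ₁), h3⟩ :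
    {t : G × X × Y // 𝓗.s (ρ t.1) = 𝓨.p t.2.2}) ∈ Subtype.val ⁻¹' V from hAB ⟨hγ'A, hB'⟩),
    𝓖.mul γ' γ₁ hcomp, Prod.ext (𝓖.r_mul _ _ _) ?_⟩
  have h4 : 𝓗.s (ρ γ₁) = 𝓨.p (σ (IsHom.unitMap 𝓖 𝓗 ρ (𝓖.s γ₁))) := by rw [hσ, hρ.s_map]
  refine (𝓨.act_congr h2 ?_ _ ((𝓗.s_mul _ _ _).trans h4)).trans (𝓨.mul_act _ _ _ h1 h4)
  rw [𝓖.s_mul]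

/-- The `𝓖`-space structure on a space `E` homeomorphic to a closed invariant subset of the fibre
product of `X` and `Y` that contains the range of a section. -/
def pullbackSpace {E : Type*} [TopologicalSpace E] (h𝓖 : 𝓖.IsEtale) (𝓨 : GSpace 𝓗 Y)
    (hρ : 𝓖.IsHom 𝓗 ρ) (hρc : Continuous ρ) {D : Set (X × Y)} (hD : IsClosed D) (e : E ≃ₜ D)
    (hDp : ∀ z ∈ D, IsHom.unitMap 𝓖 𝓗 ρ z.1 = 𝓨.p z.2)
    (hDact : ∀ z ∈ D, ∀ γ, 𝓖.s γ = z.1 → ∀ h : 𝓗.s (ρ γ) = 𝓨.p z.2,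
      (𝓖.r γ, 𝓨.act (ρ γ) z.2 h) ∈ D)
    (hDs : ∀ x, ∃ y, (x, y) ∈ D) : GSpace 𝓖 E where
  t2Space := by
    have := h𝓖.t2Space_units
    have := 𝓨.t2Space
    exact e.isEmbedding.t2Space
  locallyCompactSpace := by
    have := h𝓖.locallyCompactSpace_units
    have := 𝓨.locallyCompactSpace
    exact (hD.isClosedEmbedding_subtypeVal.comp e.isClosedEmbedding).locallyCompactSpace
  p d := (e d).1.1
  continuous_p := by fun_prop
  surjective_p x := by
    obtain ⟨y, hy⟩ := hDs x
    exact ⟨e.symm ⟨(x, y), hy⟩, by simp only [e.apply_symm_apply]⟩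
  act γ d h := e.symm ⟨(𝓖.r γ, 𝓨.act (ρ γ) (e d).1.2 (by
    rw [hρ.s_map, h, hDp _ (e d).2])), hDact _ (e d).2 γ h _⟩
  continuous_act := by
    refine e.symm.continuous.comp (Continuous.subtype_mk (Continuous.prodMk ?_ ?_) _)
    · exact h𝓖.continuous_r.comp (continuous_fst.comp continuous_subtype_val)
    · exact 𝓨.continuous_act_comp (hρc.comp (continuous_fst.comp continuous_subtype_val))
        (by fun_prop) _
  p_act γ d h := by rw [e.apply_symm_apply]
  unit_act d := by
    rw [e.symm_apply_eq]
    refine Subtype.ext (Prod.ext (𝓖.r_unit _) ?_)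
    exact (𝓨.act_congr (by rw [hρ.map_unit, hDp _ (e d).2]) rfl _ (𝓗.s_unit _)).trans
      (𝓨.unit_act _)
  mul_act γ₂ γ₁ d h h₁ := by
    refine congrArg e.symm (Subtype.ext (Prod.ext (𝓖.r_mul _ _ _) ?_))
    obtain ⟨h', e'⟩ := hρ γ₂ γ₁ h
    have h₁' : 𝓗.s (ρ γ₁) = 𝓨.p (e d).1.2 := by rw [hρ.s_map, h₁, hDp _ (e d).2]
    refine (𝓨.act_congr e' rfl _ ((𝓗.s_mul _ _ _).trans h₁')).trans
      ((𝓨.mul_act _ _ _ h' h₁').trans (𝓨.act_congr rfl ?_ _ _))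
    rw [e.apply_symm_apply]

/-- A `ρ`-equivariant map `φ` of spaces over a locally proper homomorphism `ρ` induces a proper
homomorphism of the semi-direct products. -/
theorem isEtaleProperHom_semidirect {E : Type*} [TopologicalSpace E] (h𝓖 : 𝓖.IsEtale)
    (h𝓗 : 𝓗.IsEtale) (hρc : Continuous ρ) (hρ : 𝓖.IsHom 𝓗 ρ) (hρp : 𝓖.IsLocallyProper ρ)
    (𝓔 : GSpace 𝓖 E) (𝓨 : GSpace 𝓗 Y) {φ : E → Y} (hφ : Continuous φ)
    (hφp : ∀ d, 𝓨.p (φ d) = IsHom.unitMap 𝓖 𝓗 ρ (𝓔.p d))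
    (hφact : ∀ γ d h h', φ (𝓔.act γ d h) = 𝓨.act (ρ γ) (φ d) h') :
    IsEtaleProperHom 𝓔.semidirect 𝓨.semidirect fun z =>
      ⟨(φ z.1.1, ρ z.1.2), by rw [hφp, z.2, hρ.r_map]⟩ where
  dom := 𝓔.isEtale_semidirect h𝓖
  cod := 𝓨.isEtale_semidirect h𝓗
  cont := by fun_prop
  hom a b h := by
    have hab : 𝓖.s a.1.2 = 𝓖.r b.1.2 := by
      rw [← b.2]
      exact ((congrArg 𝓔.p h.symm).trans ((𝓔.p_act _ _ _).trans (𝓖.r_inv _))).symm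
    have hs : 𝓗.s (ρ (𝓖.inv a.1.2)) = 𝓨.p (φ a.1.1) := by
      rw [hρ.s_map, 𝓖.s_inv, hφp, a.2]
    refine ⟨?_, Subtype.ext (Prod.ext rfl (hρ a.1.2 b.1.2 hab).2)⟩
    refine (𝓨.act_congr (hρ.map_inv _).symm rfl _ hs).trans ?_
    exact (hφact _ _ _ hs).symm.trans (congrArg φ h)
  proper C C' hC hC' L hL := by
    have hL' : IsCompact ((fun z : {z : Y × H // 𝓨.p z.1 = 𝓗.r z.2} => z.1.2) '' L) :=
      hL.image (by fun_prop)
    have hM := hρp.isCompact_preimage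
      ((hC.image 𝓔.continuous_p).prod (hL'.prod (hC'.image 𝓔.continuous_p)))
    refine ⟨_, (𝓔.isClosedEmbedding_val h𝓖).isCompact_preimage (hC.prod hM), fun z hr hs hl => ?_⟩
    refine ⟨hr, ⟨_, hr, z.2⟩, mem_image_of_mem _ hl, ⟨_, hs, ?_⟩⟩
    exact (𝓔.p_act _ _ _).trans (𝓖.r_inv _)

end Orbit

end GroupoidStr

/-! ### Strong amenability at infinity -/

theorem mainTheorem11 {X G : Type u} {W H : Type v}
    [TopologicalSpace X] [TopologicalSpace G] [TopologicalSpace W] [TopologicalSpace H]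
    (𝓖 : GroupoidStr X G) (𝓗 : GroupoidStr W H) (h𝓖 : 𝓖.IsEtale) (h𝓗 : 𝓗.IsEtale)
    (ρ : G → H) (hρ_cont : Continuous ρ) (hρ_hom : 𝓖.IsHom 𝓗 ρ) (hρ_proper : 𝓖.IsLocallyProper ρ)
    (h𝓗_amen : GroupoidStr.IsStronglyAmenableAtInfinity.{v, v, w} 𝓗) :
    GroupoidStr.IsStronglyAmenableAtInfinity.{u, u, u} 𝓖 := by
  obtain ⟨Y, _, 𝓨, hproper, hamen, σ, hσc, hσ⟩ := h𝓗_amen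
  have := h𝓖.t2Space_units
  have := h𝓖.locallyCompactSpace_units
  have := 𝓨.t2Space
  set q := GroupoidStr.IsHom.unitMap 𝓖 𝓗 ρ
  have hqc : Continuous q := GroupoidStr.IsHom.continuous_unitMap
    h𝓖.toIsLocallyCompactGroupoid h𝓗.toIsLocallyCompactGroupoid hρ_cont
  set D : Set (X × Y) := closure (range (GroupoidStr.orbitMap 𝓨 hρ_hom σ hσ))
  have hD : IsClosed D := isClosed_closure
  have hDp : ∀ z ∈ D, q z.1 = 𝓨.p z.2 := fun z hz =>
    GroupoidStr.unitMap_eq_of_mem_closure h𝓖.toIsLocallyCompactGroupoid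
      h𝓗.toIsLocallyCompactGroupoid hρ_cont hz
  have hDσ : ∀ x, (x, σ (q x)) ∈ D := fun x =>
    subset_closure (GroupoidStr.section_mem_range_orbitMap x)
  have hsmall : Small.{u} D := GroupoidStr.small_closure_range _
  let e : Shrink.{u} D ≃ₜ D := (Shrink.homeomorph D).symm
  let 𝓔 : GroupoidStr.GSpace 𝓖 (Shrink.{u} D) :=
    GroupoidStr.pullbackSpace h𝓖 𝓨 hρ_hom hρ_cont hD e hDp
      (fun z hz γ hγ h => GroupoidStr.act_mem_closure h𝓖.toIsLocallyCompactGroupoid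
        hρ_cont hz hγ h) fun x => ⟨_, hDσ x⟩
  refine ⟨Shrink.{u} D, inferInstance, 𝓔, ?_, ?_, fun x => e.symm ⟨(x, σ (q x)), hDσ x⟩, ?_, ?_⟩
  · refine isProperMap_iff_isCompact_preimage.2 ⟨𝓔.continuous_p, fun C hC => ?_⟩
    have hcpt := (hD.isClosedEmbedding_subtypeVal.comp e.isClosedEmbedding).isCompact_preimage
      (hC.prod (hproper.isCompact_preimage (hC.image hqc)))
    refine hcpt.of_isClosed_subset (hC.isClosed.preimage 𝓔.continuous_p) fun d hd => ?_
    exact ⟨hd, ⟨_, hd, hDp _ (e d).2⟩⟩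
  · refine (GroupoidStr.isEtaleProperHom_semidirect h𝓖 h𝓗 hρ_cont hρ_hom hρ_proper 𝓔 𝓨
      (φ := fun d => (e d).1.2) (by fun_prop) (fun d => (hDp _ (e d).2).symm) ?_).isAmenable hamen
    intro γ d h h'
    exact congrArg (fun z : D => z.1.2) (e.apply_symm_apply _)
  · exact e.symm.continuous.comp (Continuous.subtype_mk (by fun_prop) _)
  · exact fun x => congrArg (fun z : D => z.1.1) (e.apply_symm_apply _)
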